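/- Let $m<n$ be nonnegative integers and let $$K_g=\Big\{\sum_{i=0}^m b_is^i : b_i\in[\underline{b_i},\overline{b_i}]\Big\},\qquad K_f=\Big\{\sum_{i=0}^n a_is^i : a_i\in[\underline{a_i},\overline{a_i}]\Big\}$$ be real interval polynomial families (with nonempty intervals), where $0\notin[\underline{a_n},\overline{a_n}]$, so that every member of $K_f$ has order exactly $n$. Put $$\alpha_f^{(1)}(s^2)=\underline{a_0}+\overline{a_2}s^2+\underline{a_4}s^4+\overline{a_6}s^6+\cdots,\qquad \alpha_f^{(2)}(s^2)=\overline{a_0}+\underline{a_2}s^2+\overline{a_4}s^4+\underline{a_6}s^6+\cdots,$$ $$\beta_f^{(1)}(s^2)=\underline{a_1}+\overline{a_3}s^2+\underline{a_5}s^4+\overline{a_7}s^6+\cdots,\qquad \beta_f^{(2)}(s^2)=\overline{a_1}+\underline{a_3}s^2+\overline{a_5}s^4+\underline{a_7}s^6+\cdots,$$ and let $f_{ij}(s)=\alpha_f^{(i)}(s^2)+s\,\beta_f^{(j)}(s^2)$, $i,j=1,2$, be the Kharitonov vertex polynomials of $K_f$; define $g_{ij}$, $i,j=1,2$, from $K_g$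 in the same way. A polynomial is called Hurwitz if all its complex roots have negative real part. For a stable proper rational function $F$ write $\|F\|_\infty=\sup_{\omega\in\mathbb R}|F(\mathrm{i}\omega)|$ for its $H_\infty$ norm. Suppose that $g_{ij}+f_{ij}$ is Hurwitz for $i,j=1,2$. Then $f+g$ is Hurwitz for all $g\in K_g$ and $f\in K_f$ (so the norms below are those of stable transfer functions), and the following two maxima exist, are finite, and are equal: $$\max\Big\{\Big\|\frac{f}{f+g}\Big\|_\infty : g\in K_g,\ f\in K_f\Big\}=\max\Big\{\Big\|\frac{f_{i_2j_2}}{f_{i_2j_2}+g_{i_1j_1}}\Big\|_\infty : (i_1j_1i_2j_2)\in\mathcal I\Big\},$$ where $\mathcal I=\{1111,\,1212,\,2222,\,2121,\,1112,\,1222,\,2221,\,2111,\,1211,\,2212,\,2122,\,1121\}$. -/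

import Mathlib

open Polynomial
open scoped NNReal ENNReal

/-- A real polynomial is Hurwitz stable if all its complex roots lie in the open left half plane.
(The zero polynomial is not Hurwitz stable.) -/
def Hurwitz (p : ℝ[X]) : Prop :=
  ∀ z : ℂ, aeval z p = 0 → z.re < 0

/-- The real interval polynomial family of all `∑ i ≤ n, q i * s ^ i`
with `q i ∈ [lo i, hi i]` for `i = 0, …, n`. -/
def intervalFamily (n : ℕ) (lo hi : ℕ → ℝ) : Set ℝ[X] :=
  {p | ∃ q : ℕ → ℝ, (∀ i ≤ n, q i ∈ Set.Icc (lo i) (hi i)) ∧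
    p = ∑ i ∈ Finset.range (n + 1), C (q i) * X ^ i}

/-- The extreme even parts, as polynomials in `u = s ^ 2`:
`i = 1` gives `lo 0 + hi 2 * u + lo 4 * u ^ 2 + hi 6 * u ^ 3 + ⋯`,
`i = 2` gives `hi 0 + lo 2 * u + hi 4 * u ^ 2 + lo 6 * u ^ 3 + ⋯`
(coefficients of index at most `n`). -/
noncomputable def extremeEven (n : ℕ) (lo hi : ℕ → ℝ) (i : ℕ) : ℝ[X] :=
  ∑ k ∈ Finset.range (n / 2 + 1), C (if Odd (k + i) then lo (2 * k) else hi (2 * k)) * X ^ k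

/-- The extreme odd parts, as polynomials in `u = s ^ 2`:
`j = 1` gives `lo 1 + hi 3 * u + lo 5 * u ^ 2 + hi 7 * u ^ 3 + ⋯`,
`j = 2` gives `hi 1 + lo 3 * u + hi 5 * u ^ 2 + lo 7 * u ^ 3 + ⋯`
(coefficients of index at most `n`). -/
noncomputable def extremeOdd (n : ℕ) (lo hi : ℕ → ℝ) (j : ℕ) : ℝ[X] :=
  ∑ k ∈ Finset.range ((n + 1) / 2),
    C (if Odd (k + j) then lo (2 * k + 1) else hi (2 * k + 1)) * X ^ k

/-- The four Kharitonov vertex polynomials of an interval family, for `i j ∈ {1, 2}`: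
`extremeEven i (s ^ 2) + s * extremeOdd j (s ^ 2)`. -/
noncomputable def kharitonov (n : ℕ) (lo hi : ℕ → ℝ) (i j : ℕ) : ℝ[X] :=
  (extremeEven n lo hi i).comp (X ^ 2) + X * (extremeOdd n lo hi j).comp (X ^ 2)

/-- The sensitivity function `f / (f + g)` of the loop `g / f` under negative unity feedback. -/
noncomputable def sensitivity (f g : ℝ[X]) (s : ℂ) : ℂ :=
  aeval s f / (aeval s f + aeval s g)

/-- The `H∞` norm of a (stable) transfer function: the supremum of the modulus of its frequency
response over all real frequencies, with value in `[0, ∞]`. -/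
noncomputable def hInfNorm (F : ℂ → ℂ) : ℝ≥0∞ :=
  ⨆ ω : ℝ, ‖F ((ω : ℂ) * Complex.I)‖ₑ

/-- The twelve critical index quadruples `(i₁, j₁, i₂, j₂)`. -/
def criticalIndices : Finset (ℕ × ℕ × ℕ × ℕ) :=
  {(1, 1, 1, 1), (1, 2, 1, 2), (2, 2, 2, 2), (2, 1, 2, 1),
   (1, 1, 1, 2), (1, 2, 2, 2), (2, 2, 2, 1), (2, 1, 1, 1),
   (1, 2, 1, 1), (2, 2, 1, 2), (2, 1, 2, 2), (1, 1, 2, 1)}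

/-! The bridge is a small-gain argument. Since `c f + g = (f + g) + (c - 1) f`, the bound `|f / (f +
g)| ≤ γ` on the imaginary axis amounts, up to strictness, to `c f + g` having no zero there for any
`c` with `|c - 1| ≤ 1 / γ`. If `γ` exceeds the largest norm over the critical vertices, then `c f +
g` is stable for every critical vertex pair and every such `c` (`isStableNonconst_combination`). It
remains to pass from these vertices to the whole families. Strict properness makes every norm at
least `1`, so `γ > 1`; hence `Re c > 0` on the disc and the degree does not drop.

At a fixed frequency the values of `f` and of `g` lie in axis-parallel rectangles, so those of `c f
+ g` lie in an octagon with sides parallel to `1`, `i`, `c`, `ic`. For `Im c > 0` its eight corners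
come from critical index quadruples: the four diagonal ones, and four mixed ones that depend on the
sign of the frequency. As `Im c` shrinks to `0`, the octagon collapses to a rectangle, which misses
the origin by the argument behind Kharitonov's theorem (`rectangle_avoids_zero`). So if the octagon
contained the origin, then at some intermediate multiplier the origin would lie on an edge
(`octagon_avoids_zero`).

An edge cannot contain the origin, by monotonicity of phase (`IsStable.segment_avoids_zero`): its
endpoints are values of two stable polynomials whose difference keeps a fixed direction along the
axis. If the origin separated them, their equal transverse components would have to cross zero in
opposite senses. -/

/-! ### Stable complex polynomials and monotonicity of the phase -/

/-- A complex polynomial all of whose roots lie in the open left half plane. -/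
def IsStable (p : ℂ[X]) : Prop :=
  ∀ z : ℂ, p.eval z = 0 → z.re < 0

lemma IsStable.ne_zero {p : ℂ[X]} (hp : IsStable p) : p ≠ 0 := by
  rintro rfl
  have := hp 0 (by simp)
  simp at this

lemma IsStable.eval_ne_zero {p : ℂ[X]} (hp : IsStable p) {z : ℂ} (hz : 0 ≤ z.re) :
    p.eval z ≠ 0 := fun h => absurd (hp z h) (not_lt.mpr hz)

lemma IsStable.re_root_neg {p : ℂ[X]} (hp : IsStable p) {r : ℂ} (hr : r ∈ p.roots) :
    r.re < 0 := hp r ((mem_roots hp.ne_zero).1 hr)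

lemma norm_eval_eq_prod_roots (p : ℂ[X]) (z : ℂ) :
    ‖p.eval z‖ = ‖p.leadingCoeff‖ * (p.roots.map fun r => ‖z - r‖).prod := by
  rw [(IsAlgClosed.splits p).eval_eq_prod_roots, norm_mul]
  congr 1
  exact (map_multiset_prod (normHom : ℂ →*₀ ℝ) _).trans (by rw [Multiset.map_map]; rfl)

lemma card_roots_eq_natDegree (p : ℂ[X]) : p.roots.card = p.natDegree :=
  (IsAlgClosed.splits p).natDegree_eq_card_roots.symm

/-- The phase of a stable polynomial increases along the imaginary axis. -/
lemma IsStable.re_logDeriv_pos {p : ℂ[X]} (hp : IsStable p) (hd : 0 < p.natDegree) {z : ℂ}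
    (hz : 0 ≤ z.re) : 0 < (p.derivative.eval z / p.eval z).re := by
  have hne := hp.eval_ne_zero hz
  rw [(IsAlgClosed.splits p).eval_derivative_div_eval_of_ne_zero hne]
  -- The logarithmic derivative is the sum of `1 / (z - r)` over the roots; inversion preserves the
  -- right half plane.
  have hpos : ∀ r ∈ p.roots, 0 < (1 / (z - r)).re := by
    intro r hr
    have h1 := hp.re_root_neg hr
    have h2 : 0 < (z - r).re := by rw [Complex.sub_re]; linarith
    rw [one_div, Complex.inv_re]
    exact div_pos h2 (Complex.normSq_pos.2 fun h => by rw [h] at h2; simp at h2)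
  have hcard : 0 < p.roots.card := by rwa [card_roots_eq_natDegree]
  have key : ∀ s : Multiset ℂ, 0 < s.card → (∀ r ∈ s, 0 < (1 / (z - r)).re) →
      0 < ((s.map fun r => 1 / (z - r)).sum).re := by
    intro s
    induction s using Multiset.induction with
    | empty => simp
    | cons a s ih =>
      intro _ h
      rw [Multiset.map_cons, Multiset.sum_cons, Complex.add_re]
      have ha := h a (Multiset.mem_cons_self a s)
      rcases Nat.eq_zero_or_pos s.card with h0 | h0
      · rw [Multiset.card_eq_zero.1 h0]
        simpa using ha
      · exact add_pos ha (ih h0 fun r hr => h r (Multiset.mem_cons_of_mem hr))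
  exact key _ hcard hpos

lemma hasDerivAt_im_mul_eval_mul_I (p : ℂ[X]) (k : ℂ) (ω : ℝ) :
    HasDerivAt (fun w : ℝ => (k * p.eval (w * Complex.I)).im)
      (k * (p.derivative.eval (ω * Complex.I) * Complex.I)).im ω := by
  have h1 : HasDerivAt (fun w : ℝ => (w : ℂ) * Complex.I) Complex.I ω := by
    simpa using (Complex.ofRealCLM.hasDerivAt (x := ω)).mul_const Complex.I
  have h2 := ((p.hasDerivAt (ω * Complex.I)).comp ω h1).const_mul k
  exact Complex.imCLM.hasFDerivAt.comp_hasDerivAt ω h2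

/-- If two stable polynomials differ along the imaginary axis by real multiples of a fixed
direction, then the segment joining their values at a point of the axis misses the origin. -/
lemma IsStable.segment_avoids_zero {p q : ℂ[X]} (hp : IsStable p) (hq : IsStable q)
    (hpd : 0 < p.natDegree) (hqd : 0 < q.natDegree) {k : ℂ} (hk : k ≠ 0)
    (hpq : ∀ w : ℝ, (k * p.eval (w * Complex.I)).im = (k * q.eval (w * Complex.I)).im)
    {ω : ℝ} (him : (k * p.eval (ω * Complex.I)).im = 0)
    (hpre : (k * p.eval (ω * Complex.I)).re ≤ 0) (hqre : 0 ≤ (k * q.eval (ω * Complex.I)).re) :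
    False := by
  have hz : 0 ≤ ((ω : ℂ) * Complex.I).re := by simp
  have hp0 := hp.eval_ne_zero hz
  have hq0 := hq.eval_ne_zero hz
  have hp1 := hp.re_logDeriv_pos hpd hz
  have hq1 := hq.re_logDeriv_pos hqd hz
  have hd := hasDerivAt_im_mul_eval_mul_I p k ω
  rw [funext hpq] at hd
  have hd' := hd.unique (hasDerivAt_im_mul_eval_mul_I q k ω)
  have himq : (k * q.eval (ω * Complex.I)).im = 0 := by rw [← hpq, him]
  -- Where `k r` is real, the derivative of its imaginary part along the axis is its value times the
  -- positive number `Re (r' / r)`. The two imaginary parts coincide identically, so these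
  -- derivatives agree, although their signs do not.
  have key : ∀ r : ℂ[X], r.eval (ω * Complex.I) ≠ 0 → (k * r.eval (ω * Complex.I)).im = 0 →
      (k * (r.derivative.eval (ω * Complex.I) * Complex.I)).im =
        (k * r.eval (ω * Complex.I)).re *
          (r.derivative.eval (ω * Complex.I) / r.eval (ω * Complex.I)).re := by
    intro r hr hi
    have : k * (r.derivative.eval (ω * Complex.I) * Complex.I) =
        (k * r.eval (ω * Complex.I)) *
          (r.derivative.eval (ω * Complex.I) / r.eval (ω * Complex.I)) * Complex.I := by
      field_simp
    rw [this, Complex.mul_I_im, Complex.mul_re, hi]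
    ring
  rw [key p hp0 him, key q hq0 himq] at hd'
  have hpne : (k * p.eval (ω * Complex.I)).re ≠ 0 := fun h =>
    mul_ne_zero hk hp0 (Complex.ext h him)
  have h1 := mul_neg_of_neg_of_pos (lt_of_le_of_ne hpre hpne) hp1
  have h2 := mul_nonneg hqre hq1.le
  linarith

/-! ### Growth estimates on the closed right half plane -/

/-- The distance to `r` is at least `-Re r`, which absorbs the constant in `1 + ‖z‖ ≤ (1 + ‖r‖) + ‖z
- r‖`. -/
lemma exists_pos_mul_le_norm_sub {r : ℂ} (hr : r.re < 0) :
    ∃ ε > 0, ∀ z : ℂ, 0 ≤ z.re → ε * (1 + ‖z‖) ≤ ‖z - r‖ := by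
  have hd : 0 < -r.re := by linarith
  refine ⟨1 / ((1 + ‖r‖) / (-r.re) + 1), by positivity, fun z hz => ?_⟩
  have h1 : -r.re ≤ ‖z - r‖ := by
    have := Complex.re_le_norm (z - r)
    rw [Complex.sub_re] at this
    linarith
  have h2 : ‖z‖ ≤ ‖z - r‖ + ‖r‖ := by simpa using norm_add_le (z - r) r
  have h3 : 1 + ‖r‖ ≤ (1 + ‖r‖) / (-r.re) * ‖z - r‖ := by
    rw [div_mul_eq_mul_div, le_div_iff₀ hd]
    exact mul_le_mul_of_nonneg_left h1 (by positivity)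
  rw [one_div, inv_mul_le_iff₀ (by positivity)]
  linarith

/-- A stable polynomial grows like `‖z‖ ^ natDegree` on the closed right half plane. -/
lemma IsStable.exists_pos_mul_pow_le_norm_eval {p : ℂ[X]} (hp : IsStable p) :
    ∃ ε > 0, ∀ z : ℂ, 0 ≤ z.re → ε * (1 + ‖z‖) ^ p.natDegree ≤ ‖p.eval z‖ := by
  have key : ∀ s : Multiset ℂ, (∀ r ∈ s, r.re < 0) → ∃ ε > 0, ∀ z : ℂ, 0 ≤ z.re →
      ε * (1 + ‖z‖) ^ s.card ≤ (s.map fun r => ‖z - r‖).prod := by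
    intro s
    induction s using Multiset.induction with
    | empty => exact fun _ => ⟨1, one_pos, fun z _ => by simp⟩
    | cons a s ih =>
      intro h
      obtain ⟨ε, hε, h1⟩ := ih fun r hr => h r (Multiset.mem_cons_of_mem hr)
      obtain ⟨η, hη, h2⟩ := exists_pos_mul_le_norm_sub (h a (Multiset.mem_cons_self a s))
      refine ⟨η * ε, by positivity, fun z hz => ?_⟩
      rw [Multiset.map_cons, Multiset.prod_cons, Multiset.card_cons, pow_succ]
      calc η * ε * ((1 + ‖z‖) ^ s.card * (1 + ‖z‖))
          = (η * (1 + ‖z‖)) * (ε * (1 + ‖z‖) ^ s.card) := by ring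
        _ ≤ _ := mul_le_mul (h2 z hz) (h1 z hz) (by positivity) (norm_nonneg _)
  obtain ⟨ε, hε, h⟩ := key p.roots fun r hr => hp.re_root_neg hr
  have hl : 0 < ‖p.leadingCoeff‖ := norm_pos_iff.2 (leadingCoeff_ne_zero.2 hp.ne_zero)
  refine ⟨‖p.leadingCoeff‖ * ε, by positivity, fun z hz => ?_⟩
  rw [norm_eval_eq_prod_roots, mul_assoc, ← card_roots_eq_natDegree]
  exact mul_le_mul_of_nonneg_left (h z hz) hl.le

/-- Every factor `‖z - r‖` is at least `Re z`. The bound depends on the polynomial only through its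
degree and leading coefficient, so it is uniform along a segment and shows that instability is an
open condition. -/
lemma IsStable.norm_leadingCoeff_mul_re_pow_le {p : ℂ[X]} (hp : IsStable p) {z : ℂ}
    (hz : 0 ≤ z.re) : ‖p.leadingCoeff‖ * z.re ^ p.natDegree ≤ ‖p.eval z‖ := by
  have key : ∀ s : Multiset ℂ, (∀ r ∈ s, r.re < 0) →
      z.re ^ s.card ≤ (s.map fun r => ‖z - r‖).prod := by
    intro s
    induction s using Multiset.induction with
    | empty => simp
    | cons a s ih =>
      intro h
      have ha := h a (Multiset.mem_cons_self a s)
      rw [Multiset.map_cons, Multiset.prod_cons, Multiset.card_cons, pow_succ']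
      refine mul_le_mul ?_ (ih fun r hr => h r (Multiset.mem_cons_of_mem hr)) (by positivity)
        (norm_nonneg _)
      have := Complex.re_le_norm (z - a)
      rw [Complex.sub_re] at this
      linarith
  rw [norm_eval_eq_prod_roots, ← card_roots_eq_natDegree]
  exact mul_le_mul_of_nonneg_left (key _ fun r hr => hp.re_root_neg hr) (norm_nonneg _)

lemma exists_norm_eval_le_mul_pow (p : ℂ[X]) {n : ℕ} (hn : p.natDegree ≤ n) :
    ∃ K ≥ 0, ∀ z : ℂ, ‖p.eval z‖ ≤ K * (1 + ‖z‖) ^ n := by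
  refine ⟨∑ i ∈ Finset.range (n + 1), ‖p.coeff i‖, by positivity, fun z => ?_⟩
  rw [eval_eq_sum_range' (Nat.lt_succ_of_le hn), Finset.sum_mul]
  refine (norm_sum_le _ _).trans (Finset.sum_le_sum fun i hi => ?_)
  rw [norm_mul, norm_pow]
  refine mul_le_mul_of_nonneg_left ?_ (norm_nonneg _)
  calc ‖z‖ ^ i ≤ (1 + ‖z‖) ^ i := by gcongr; linarith
    _ ≤ (1 + ‖z‖) ^ n :=
      pow_le_pow_right₀ (by linarith [norm_nonneg z]) (Nat.lt_succ_iff.1 (Finset.mem_range.1 hi))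

/-! ### Stability along a segment of polynomials -/

/-- The point with parameter `t` of the segment from `p` to `q`. -/
noncomputable def segmentPoly (p q : ℂ[X]) (t : ℝ) : ℂ[X] := C (1 - t : ℂ) * p + C (t : ℂ) * q

lemma eval_segmentPoly (p q : ℂ[X]) (t : ℝ) (z : ℂ) :
    (segmentPoly p q t).eval z = (1 - t) * p.eval z + t * q.eval z := by
  simp [segmentPoly]

lemma coeff_segmentPoly (p q : ℂ[X]) (t : ℝ) (i : ℕ) :
    (segmentPoly p q t).coeff i = (1 - t) * p.coeff i + t * q.coeff i := by
  simp only [segmentPoly, coeff_add, coeff_C_mul]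

lemma natDegree_segmentPoly_le {p q : ℂ[X]} {n : ℕ} (hp : p.natDegree ≤ n)
    (hq : q.natDegree ≤ n) (t : ℝ) : (segmentPoly p q t).natDegree ≤ n :=
  natDegree_add_le_of_degree_le ((natDegree_C_mul_le _ _).trans hp)
    ((natDegree_C_mul_le _ _).trans hq)

/-- On the closed right half plane the polynomial at `t₀` is at least `ε (1 + ‖z‖) ^ n`, while the
perturbation is at most `|t - t₀| K (1 + ‖z‖) ^ n`. The common power handles all `z` at once,
including those near infinity. -/
lemma eventually_isStable_segmentPoly {p q : ℂ[X]} {n : ℕ} (hp : p.natDegree ≤ n)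
    (hq : q.natDegree ≤ n) {t₀ : ℝ} (hc : (segmentPoly p q t₀).coeff n ≠ 0)
    (hs : IsStable (segmentPoly p q t₀)) :
    ∀ᶠ t in nhds t₀, IsStable (segmentPoly p q t) := by
  have hdeg : (segmentPoly p q t₀).natDegree = n :=
    natDegree_eq_of_le_of_coeff_ne_zero (natDegree_segmentPoly_le hp hq t₀) hc
  obtain ⟨ε, hε, h1⟩ := hs.exists_pos_mul_pow_le_norm_eval
  rw [hdeg] at h1
  obtain ⟨K, hK, h2⟩ := exists_norm_eval_le_mul_pow (q - p) (n := n)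
    ((natDegree_sub_le _ _).trans (max_le hq hp))
  have hev : ∀ᶠ t in nhds t₀, |t - t₀| * K < ε := by
    have hcont : Continuous fun t : ℝ => |t - t₀| * K := by fun_prop
    have := hcont.tendsto t₀
    simp only [sub_self, abs_zero, zero_mul] at this
    exact this.eventually (gt_mem_nhds hε)
  filter_upwards [hev] with t ht z hz0
  by_contra hz
  push Not at hz
  have h3 := h1 z hz
  have h4 : (segmentPoly p q t₀).eval z = -((t - t₀ : ℝ) : ℂ) * (q - p).eval z := by
    rw [eval_segmentPoly] at hz0 ⊢
    rw [eval_sub]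
    push_cast
    linear_combination hz0
  rw [h4, norm_mul, norm_neg, Complex.norm_real, Real.norm_eq_abs] at h3
  have h5 : |t - t₀| * ‖(q - p).eval z‖ ≤ |t - t₀| * (K * (1 + ‖z‖) ^ n) :=
    mul_le_mul_of_nonneg_left (h2 z) (abs_nonneg _)
  have h6 : |t - t₀| * K * (1 + ‖z‖) ^ n < ε * (1 + ‖z‖) ^ n :=
    mul_lt_mul_of_pos_right ht (by positivity)
  linarith

/-- Stability at `t` would force the value at `z` to be at least the leading coefficient times `(Re
z) ^ n` in modulus. This fails at `t₀`, hence nearby by continuity. -/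
lemma eventually_not_isStable_segmentPoly {p q : ℂ[X]} {n : ℕ} (hp : p.natDegree ≤ n)
    (hq : q.natDegree ≤ n) {t₀ : ℝ} (hc : (segmentPoly p q t₀).coeff n ≠ 0)
    {z : ℂ} (hz : 0 < z.re) (hz0 : (segmentPoly p q t₀).eval z = 0) :
    ∀ᶠ t in nhds t₀, ¬ IsStable (segmentPoly p q t) := by
  have hcont : Continuous fun t : ℝ =>
      ‖(segmentPoly p q t).coeff n‖ * z.re ^ n - ‖(segmentPoly p q t).eval z‖ := by
    simp only [coeff_segmentPoly, eval_segmentPoly]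
    fun_prop
  have hpos : 0 < ‖(segmentPoly p q t₀).coeff n‖ * z.re ^ n -
      ‖(segmentPoly p q t₀).eval z‖ := by
    rw [hz0, norm_zero, sub_zero]
    have := norm_pos_iff.2 hc
    positivity
  have hcont' : Continuous fun t : ℝ => ‖(segmentPoly p q t).coeff n‖ := by
    simp only [coeff_segmentPoly]
    fun_prop
  filter_upwards [(hcont.tendsto t₀).eventually (lt_mem_nhds hpos),
    (hcont'.tendsto t₀).eventually (lt_mem_nhds (norm_pos_iff.2 hc))] with t ht ht' hs
  have hdeg : (segmentPoly p q t).natDegree = n :=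
    natDegree_eq_of_le_of_coeff_ne_zero (natDegree_segmentPoly_le hp hq t) (norm_pos_iff.1 ht')
  have := hs.norm_leadingCoeff_mul_re_pow_le hz.le
  rw [leadingCoeff, hdeg] at this
  linarith

/-- Stability is preserved along a segment of polynomials of constant degree without zeros on
the imaginary axis. -/
lemma IsStable.of_segment {p q : ℂ[X]} {n : ℕ} (hp : p.natDegree ≤ n) (hq : q.natDegree ≤ n)
    (hc : ∀ t ∈ Set.Icc (0 : ℝ) 1, (1 - t) * p.coeff n + t * q.coeff n ≠ 0)
    (hax : ∀ t ∈ Set.Icc (0 : ℝ) 1, ∀ ω : ℝ,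
      (1 - t) * p.eval (ω * Complex.I) + t * q.eval (ω * Complex.I) ≠ 0)
    (hs : IsStable p) : IsStable q := by
  -- Stability is locally constant in the parameter, and the interval is connected.
  have key := (isPreconnected_Icc (a := (0 : ℝ)) (b := 1)).induction₂
    (fun s t => IsStable (segmentPoly p q s) ↔ IsStable (segmentPoly p q t)) ?_
    (fun _ _ _ _ _ _ h1 h2 => h1.trans h2) (fun _ _ _ _ h => h.symm)
    (Set.left_mem_Icc.2 zero_le_one) (Set.right_mem_Icc.2 zero_le_one)
  · have h0 : segmentPoly p q 0 = p := by simp [segmentPoly]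
    have h1 : segmentPoly p q 1 = q := by simp [segmentPoly]
    rw [h0, h1] at key
    exact key.1 hs
  · intro t ht
    have hct : (segmentPoly p q t).coeff n ≠ 0 := by
      rw [coeff_segmentPoly]; exact hc t ht
    refine nhdsWithin_le_nhds ?_
    by_cases hst : IsStable (segmentPoly p q t)
    · filter_upwards [eventually_isStable_segmentPoly hp hq hct hst] with u hu
      exact iff_of_true hst hu
    · have := hst
      unfold IsStable at this
      push Not at this
      obtain ⟨z, hz0, hz⟩ := this
      -- Zeros on the axis are excluded, so an unstable root lies strictly to the right.
      have hz' : 0 < z.re := by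
        refine lt_of_le_of_ne hz fun h => ?_
        have hzI : z = (z.im : ℂ) * Complex.I := Complex.ext (by simp [← h]) (by simp)
        rw [hzI, eval_segmentPoly] at hz0
        exact hax t ht _ hz0
      filter_upwards [eventually_not_isStable_segmentPoly hp hq hct hz' hz0] with u hu
      exact iff_of_false hst hu

/-! ### Even and odd parts of real polynomials -/

/-- The real polynomial `p` read as a complex polynomial. -/
noncomputable def complexify (p : ℝ[X]) : ℂ[X] := p.map (algebraMap ℝ ℂ)

/-- The polynomial with even part `α (s ^ 2)` and odd part `s * β (s ^ 2)`. -/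
noncomputable def evenOdd (α β : ℝ[X]) : ℝ[X] := α.comp (X ^ 2) + X * β.comp (X ^ 2)

/-- The point with parameter `t` of the segment between two real polynomials. -/
noncomputable def lerp (p q : ℝ[X]) (t : ℝ) : ℝ[X] := C (1 - t) * p + C t * q

lemma eval_lerp (p q : ℝ[X]) (t u : ℝ) :
    (lerp p q t).eval u = (1 - t) * p.eval u + t * q.eval u := by simp [lerp]

lemma evenOdd_lerp_left (α₁ α₂ β : ℝ[X]) (t : ℝ) :
    evenOdd (lerp α₁ α₂ t) β = lerp (evenOdd α₁ β) (evenOdd α₂ β) t := by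
  simp only [evenOdd, lerp, add_comp, mul_comp, C_comp, C_sub, C_1, sub_comp, one_comp]
  ring

lemma evenOdd_lerp_right (α β₁ β₂ : ℝ[X]) (t : ℝ) :
    evenOdd α (lerp β₁ β₂ t) = lerp (evenOdd α β₁) (evenOdd α β₂) t := by
  simp only [evenOdd, lerp, add_comp, mul_comp, C_comp, C_sub, C_1, sub_comp, one_comp]
  ring

lemma evenOdd_add (α β α' β' : ℝ[X]) :
    evenOdd α β + evenOdd α' β' = evenOdd (α + α') (β + β') := by
  simp only [evenOdd, add_comp]
  ring

lemma C_mul_evenOdd (x : ℝ) (α β : ℝ[X]) :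
    C x * evenOdd α β = evenOdd (C x * α) (C x * β) := by
  simp only [evenOdd, mul_comp, C_comp]
  ring

lemma complexify_lerp (p q : ℝ[X]) (t : ℝ) :
    complexify (lerp p q t) = segmentPoly (complexify p) (complexify q) t := by
  simp [lerp, segmentPoly, complexify]

lemma eval_complexify_evenOdd (α β : ℝ[X]) (ω : ℝ) :
    (complexify (evenOdd α β)).eval (ω * Complex.I) =
      ⟨α.eval (-ω ^ 2), ω * β.eval (-ω ^ 2)⟩ := by
  have hsq : ((ω : ℂ) * Complex.I) ^ 2 = ((-ω ^ 2 : ℝ) : ℂ) := by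
    rw [mul_pow, Complex.I_sq]; push_cast; ring
  have hev : ∀ p : ℝ[X], (p.map (algebraMap ℝ ℂ)).eval ((-ω ^ 2 : ℝ) : ℂ) =
      ((p.eval (-ω ^ 2) : ℝ) : ℂ) := fun p => by
    rw [← Complex.coe_algebraMap, eval_map_apply]
  simp only [complexify, evenOdd, Polynomial.map_add, Polynomial.map_mul, map_comp,
    Polynomial.map_pow, map_X, eval_add, eval_mul, eval_comp, eval_pow, eval_X, hsq, hev]
  apply Complex.ext <;> simp

/-- If two stable polynomials differ along the imaginary axis by real multiples of a fixed
direction, then no convex combination of them vanishes on the axis. -/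
lemma IsStable.segment_ne_zero {p q : ℂ[X]} (hp : IsStable p) (hq : IsStable q)
    (hpd : 0 < p.natDegree) (hqd : 0 < q.natDegree) {k : ℂ} (hk : k ≠ 0)
    (hpq : ∀ w : ℝ, (k * p.eval (w * Complex.I)).im = (k * q.eval (w * Complex.I)).im)
    (ω : ℝ) {t : ℝ} (ht : t ∈ Set.Icc (0 : ℝ) 1) :
    (1 - t) * p.eval (ω * Complex.I) + t * q.eval (ω * Complex.I) ≠ 0 := by
  intro h0
  set P := k * p.eval (ω * Complex.I) with hP
  set Q := k * q.eval (ω * Complex.I) with hQ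
  have h : ((1 - t : ℝ) : ℂ) * P + (t : ℂ) * Q = 0 := by
    rw [hP, hQ]; push_cast; linear_combination k * h0
  have him : P.im = Q.im := hpq ω
  have hre := congrArg Complex.re h
  have him' := congrArg Complex.im h
  simp only [Complex.add_re, Complex.add_im, Complex.re_ofReal_mul, Complex.im_ofReal_mul,
    Complex.zero_re, Complex.zero_im] at hre him'
  have hP0 : P.im = 0 := by rw [← him] at him'; linarith
  -- Both values are now real after multiplication by `k`. Opposite signs contradict the phase
  -- argument; equal strict signs keep the convex combination away from zero.
  rcases le_total P.re 0 with hs | hs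
  · by_cases hq0 : 0 ≤ Q.re
    · exact hp.segment_avoids_zero hq hpd hqd hk hpq hP0 hs hq0
    · push Not at hq0
      have hP1 : P.re ≠ 0 := fun hh => mul_ne_zero hk (hp.eval_ne_zero (by simp))
        (Complex.ext hh hP0)
      have hP2 : P.re < 0 := lt_of_le_of_ne hs hP1
      rcases eq_or_lt_of_le ht.1 with h1 | h1
      · rw [← h1] at hre; linarith
      · nlinarith [mul_neg_of_pos_of_neg h1 hq0, mul_nonneg (sub_nonneg.2 ht.2) (neg_nonneg.2 hs)]
  · by_cases hq0 : Q.re ≤ 0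
    · exact hq.segment_avoids_zero hp hqd hpd hk (fun w => (hpq w).symm) (him ▸ hP0) hq0 hs
    · push Not at hq0
      have hP1 : P.re ≠ 0 := fun hh => mul_ne_zero hk (hp.eval_ne_zero (by simp))
        (Complex.ext hh hP0)
      have hP2 : 0 < P.re := lt_of_le_of_ne hs hP1.symm
      rcases eq_or_lt_of_le ht.1 with h1 | h1
      · rw [← h1] at hre; linarith
      · nlinarith [mul_pos h1 hq0, mul_nonneg (sub_nonneg.2 ht.2) hs]

/-! ### Stable segments and Kharitonov's theorem -/

/-- A stable real polynomial of degree `n` whose leading coefficient has the sign of `σ`. -/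
structure StableOfDegree (n : ℕ) (σ : ℝ) (p : ℝ[X]) : Prop where
  stable : IsStable (complexify p)
  natDegree_le : p.natDegree ≤ n
  coeff_pos : 0 < σ * p.coeff n

lemma StableOfDegree.natDegree_eq {n : ℕ} {σ : ℝ} {p : ℝ[X]} (h : StableOfDegree n σ p) :
    p.natDegree = n :=
  natDegree_eq_of_le_of_coeff_ne_zero h.natDegree_le fun h0 => by
    have := h.coeff_pos; rw [h0, mul_zero] at this; exact lt_irrefl _ this

lemma natDegree_complexify (p : ℝ[X]) : (complexify p).natDegree = p.natDegree :=
  natDegree_map _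

lemma convexComb_pos {σ a b t : ℝ} (ha : 0 < σ * a) (hb : 0 < σ * b)
    (ht : t ∈ Set.Icc (0 : ℝ) 1) : 0 < σ * ((1 - t) * a + t * b) := by
  have := (convex_Ioi (0 : ℝ)) (Set.mem_Ioi.2 ha) (Set.mem_Ioi.2 hb) (sub_nonneg.2 ht.2) ht.1
    (by ring)
  simp only [smul_eq_mul, Set.mem_Ioi] at this
  linarith

lemma convexComb_coeff_complexify_ne_zero {n : ℕ} {σ : ℝ} {p q : ℝ[X]}
    (hp : 0 < σ * p.coeff n) (hq : 0 < σ * q.coeff n) {t : ℝ} (ht : t ∈ Set.Icc (0 : ℝ) 1) :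
    (1 - t) * (complexify p).coeff n + t * (complexify q).coeff n ≠ 0 := by
  have h := convexComb_pos hp hq ht
  simp only [complexify, coeff_map, Complex.coe_algebraMap]
  intro h0
  have h1 : (1 - t) * p.coeff n + t * q.coeff n = 0 := by exact_mod_cast h0
  rw [h1, mul_zero] at h
  exact lt_irrefl _ h

/-- Two stable polynomials that differ in a convex direction span a stable segment. -/
lemma StableOfDegree.lerp {n : ℕ} {σ : ℝ} {p q : ℝ[X]} (hn : 0 < n)
    (hp : StableOfDegree n σ p) (hq : StableOfDegree n σ q) {k : ℂ} (hk : k ≠ 0)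
    (hpq : ∀ w : ℝ, (k * (complexify p).eval (w * Complex.I)).im =
      (k * (complexify q).eval (w * Complex.I)).im) {t : ℝ} (ht : t ∈ Set.Icc (0 : ℝ) 1) :
    StableOfDegree n σ (lerp p q t) := by
  have hcoeff : 0 < σ * (_root_.lerp p q t).coeff n := by
    simp only [_root_.lerp, coeff_add, coeff_C_mul]
    exact convexComb_pos hp.coeff_pos hq.coeff_pos ht
  have hdeg : (_root_.lerp p q t).natDegree ≤ n :=
    natDegree_add_le_of_degree_le ((natDegree_C_mul_le _ _).trans hp.natDegree_le)
      ((natDegree_C_mul_le _ _).trans hq.natDegree_le)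
  refine ⟨?_, hdeg, hcoeff⟩
  refine hp.stable.of_segment (n := n) ((natDegree_complexify p).trans_le hp.natDegree_le)
    ((natDegree_complexify _).trans_le hdeg)
    (fun s hs => convexComb_coeff_complexify_ne_zero hp.coeff_pos hcoeff hs)
    (fun s hs ω => ?_)
  -- The point `s` between `p` and the point `t` of the segment is the point `s * t` of the full
  -- segment.
  have hst : s * t ∈ Set.Icc (0 : ℝ) 1 :=
    ⟨mul_nonneg hs.1 ht.1, mul_le_one₀ hs.2 ht.1 ht.2⟩
  have := hp.stable.segment_ne_zero hq.stable
    (by rw [natDegree_complexify, hp.natDegree_eq]; exact hn)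
    (by rw [natDegree_complexify, hq.natDegree_eq]; exact hn) hk hpq ω hst
  rw [complexify_lerp, eval_segmentPoly]
  convert this using 1
  push_cast
  ring

lemma exists_convexComb_eq_zero {x y : ℝ} (h : (0 : ℝ) ∈ Set.uIcc x y) :
    ∃ t ∈ Set.Icc (0 : ℝ) 1, (1 - t) * x + t * y = 0 := by
  rw [← segment_eq_uIcc, segment_eq_image] at h
  simpa using h

section Rectangle

variable {n : ℕ} {σ : ℝ} {α₁ α₂ β₁ β₂ : ℝ[X]}

/-- The rectangle spanned by the values of four stable vertex polynomials at a point of the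
imaginary axis misses the origin. -/
lemma rectangle_avoids_zero (hn : 0 < n)
    (h11 : StableOfDegree n σ (evenOdd α₁ β₁)) (h12 : StableOfDegree n σ (evenOdd α₁ β₂))
    (h21 : StableOfDegree n σ (evenOdd α₂ β₁)) (h22 : StableOfDegree n σ (evenOdd α₂ β₂))
    (ω : ℝ) (hα : (0 : ℝ) ∈ Set.uIcc (α₁.eval (-ω ^ 2)) (α₂.eval (-ω ^ 2)))
    (hβ : (0 : ℝ) ∈ Set.uIcc (ω * β₁.eval (-ω ^ 2)) (ω * β₂.eval (-ω ^ 2))) : False := by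
  obtain ⟨s, hs, hs0⟩ := exists_convexComb_eq_zero hα
  obtain ⟨r, hr, hr0⟩ := exists_convexComb_eq_zero hβ
  -- Interpolate the odd parts first, where the difference is imaginary on the axis, and then the
  -- even parts, where it is real. The resulting stable polynomial would vanish at `iω`.
  have hedge : ∀ α : ℝ[X], StableOfDegree n σ (evenOdd α β₁) →
      StableOfDegree n σ (evenOdd α β₂) → StableOfDegree n σ (evenOdd α (lerp β₁ β₂ r)) := by
    intro α h1 h2
    rw [evenOdd_lerp_right]
    refine h1.lerp hn h2 Complex.I_ne_zero (fun w => ?_) hr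
    simp only [eval_complexify_evenOdd, Complex.I_mul_im]
  have h := (hedge α₁ h11 h12).lerp hn (hedge α₂ h21 h22) one_ne_zero
    (fun w => by simp only [eval_complexify_evenOdd, one_mul]) hs
  rw [← evenOdd_lerp_left] at h
  refine h.stable.eval_ne_zero (z := ω * Complex.I) (by simp) ?_
  rw [eval_complexify_evenOdd, eval_lerp, eval_lerp, hs0]
  apply Complex.ext
  · rfl
  · simp only [Complex.zero_im]
    linarith

/-- Kharitonov's theorem: if the four vertex polynomials are stable, then so is every polynomial
of the same degree whose even and odd parts lie between those of the vertices. -/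
lemma StableOfDegree.of_rectangle (hn : 0 < n)
    (h11 : StableOfDegree n σ (evenOdd α₁ β₁)) (h12 : StableOfDegree n σ (evenOdd α₁ β₂))
    (h21 : StableOfDegree n σ (evenOdd α₂ β₁)) (h22 : StableOfDegree n σ (evenOdd α₂ β₂))
    {α β : ℝ[X]} (hα : ∀ u ≤ 0, α.eval u ∈ Set.Icc (α₁.eval u) (α₂.eval u))
    (hβ : ∀ u ≤ 0, β.eval u ∈ Set.Icc (β₁.eval u) (β₂.eval u))
    (hdeg : (evenOdd α β).natDegree ≤ n) (hcoeff : 0 < σ * (evenOdd α β).coeff n) :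
    StableOfDegree n σ (evenOdd α β) := by
  refine ⟨h11.stable.of_segment (n := n) ((natDegree_complexify _).trans_le h11.natDegree_le)
    ((natDegree_complexify _).trans_le hdeg)
    (fun s hs => convexComb_coeff_complexify_ne_zero h11.coeff_pos hcoeff hs)
    (fun t ht ω h0 => ?_), hdeg, hcoeff⟩
  have hu : -ω ^ 2 ≤ 0 := by nlinarith [sq_nonneg ω]
  -- The homotopy from the `11` vertex stays inside the rectangle.
  have key : ∀ a b c : ℝ, b ∈ Set.Icc a c → a ≤ (1 - t) * a + t * b ∧ (1 - t) * a + t * b ≤ c := by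
    intro a b c h
    constructor
    · nlinarith [mul_nonneg ht.1 (sub_nonneg.2 h.1)]
    · nlinarith [mul_nonneg (sub_nonneg.2 ht.2) (sub_nonneg.2 h.1), h.2]
  have hre := congrArg Complex.re h0
  have him := congrArg Complex.im h0
  rw [eval_complexify_evenOdd, eval_complexify_evenOdd] at hre him
  simp at hre him
  have hα' := key _ _ _ (hα _ hu)
  have hβ' := key _ _ _ (hβ _ hu)
  refine rectangle_avoids_zero hn h11 h12 h21 h22 ω ?_ ?_
  · rw [hre] at hα'
    exact Set.mem_uIcc_of_le hα'.1 hα'.2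
  · have h1 : ω * ((1 - t) * β₁.eval (-ω ^ 2) + t * β.eval (-ω ^ 2)) = 0 := by linarith
    rcases le_total 0 ω with hω | hω
    · refine Set.mem_uIcc_of_le ?_ ?_ <;> rw [← h1]
      exacts [mul_le_mul_of_nonneg_left hβ'.1 hω, mul_le_mul_of_nonneg_left hβ'.2 hω]
    · refine Set.mem_uIcc_of_ge ?_ ?_ <;> rw [← h1]
      exacts [mul_le_mul_of_nonpos_left hβ'.2 hω, mul_le_mul_of_nonpos_left hβ'.1 hω]

end Rectangle

/-! ### The octagon of values of `c * f + g` -/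

/-- The complex polynomial `c * f + g`. -/
noncomputable def combination (c : ℂ) (f g : ℝ[X]) : ℂ[X] := C c * complexify f + complexify g

lemma eval_combination (c : ℂ) (f g : ℝ[X]) (z : ℂ) :
    (combination c f g).eval z = c * (complexify f).eval z + (complexify g).eval z := by
  simp only [combination, eval_add, eval_mul, eval_C]

lemma eval_combination_evenOdd (c : ℂ) (A B a b : ℝ[X]) (ω : ℝ) :
    (combination c (evenOdd A B) (evenOdd a b)).eval (ω * Complex.I) =
      ⟨a.eval (-ω ^ 2) + (c.re * A.eval (-ω ^ 2) - c.im * (ω * B.eval (-ω ^ 2))),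
        ω * b.eval (-ω ^ 2) + (c.im * A.eval (-ω ^ 2) + c.re * (ω * B.eval (-ω ^ 2)))⟩ := by
  rw [eval_combination, eval_complexify_evenOdd, eval_complexify_evenOdd]
  apply Complex.ext
  · simp only [Complex.add_re, Complex.mul_re]; ring
  · simp only [Complex.add_im, Complex.mul_im]; ring

/-- A stable complex polynomial that is not constant. -/
def IsStableNonconst (p : ℂ[X]) : Prop := IsStable p ∧ 0 < p.natDegree

lemma IsStableNonconst.edge {p q : ℂ[X]} (hp : IsStableNonconst p) (hq : IsStableNonconst q)
    {k : ℂ} (hk : k ≠ 0)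
    (hpq : ∀ w : ℝ, (k * p.eval (w * Complex.I)).im = (k * q.eval (w * Complex.I)).im)
    {ω : ℝ} (him : (k * p.eval (ω * Complex.I)).im = 0)
    (hpre : (k * p.eval (ω * Complex.I)).re ≤ 0) (hqre : 0 ≤ (k * q.eval (ω * Complex.I)).re) :
    False :=
  hp.1.segment_avoids_zero hq.1 hp.2 hq.2 hk hpq him hpre hqre

/-- The signed support functions, in the eight directions `±1, ±i, ±c, ±ic` with `c = x + iy`, of
the octagon `c * ([A₁, A₂] + i [B₁, B₂]) + ([a₁, a₂] + i [b₁, b₂])`. -/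
def octagonSupport (a₁ a₂ b₁ b₂ A₁ A₂ B₁ B₂ x y : ℝ) : Fin 8 → ℝ :=
  ![a₂ + (x * A₂ - y * B₁), -(a₁ + (x * A₁ - y * B₂)),
    -(b₁ + (y * A₁ + x * B₁)), b₂ + (y * A₂ + x * B₂),
    -(x * a₁ + y * b₁ + (x ^ 2 + y ^ 2) * A₁), x * a₂ + y * b₂ + (x ^ 2 + y ^ 2) * A₂,
    -(x * b₁ - y * a₂ + (x ^ 2 + y ^ 2) * B₁), x * b₂ - y * a₁ + (x ^ 2 + y ^ 2) * B₂]

/-- If the origin is in the octagon, no linear functional has a negative maximum there. The signs of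
`x` and `y` decide which corners are extremal; `e1` and `e2` are the real and imaginary parts of the
equation multiplied by the conjugate of `c`. -/
lemma octagonSupport_nonneg {a₁ a₂ b₁ b₂ A₁ A₂ B₁ B₂ x y a b A B : ℝ} (hx : 0 ≤ x) (hy : 0 ≤ y)
    (ha : a ∈ Set.Icc a₁ a₂) (hb : b ∈ Set.Icc b₁ b₂) (hA : A ∈ Set.Icc A₁ A₂)
    (hB : B ∈ Set.Icc B₁ B₂) (hre : a + (x * A - y * B) = 0) (him : b + (y * A + x * B) = 0)
    (i : Fin 8) : 0 ≤ octagonSupport a₁ a₂ b₁ b₂ A₁ A₂ B₁ B₂ x y i := by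
  obtain ⟨ha1, ha2⟩ := ha
  obtain ⟨hb1, hb2⟩ := hb
  obtain ⟨hA1, hA2⟩ := hA
  obtain ⟨hB1, hB2⟩ := hB
  have xA1 := mul_le_mul_of_nonneg_left hA1 hx
  have xA2 := mul_le_mul_of_nonneg_left hA2 hx
  have yA1 := mul_le_mul_of_nonneg_left hA1 hy
  have yA2 := mul_le_mul_of_nonneg_left hA2 hy
  have xB1 := mul_le_mul_of_nonneg_left hB1 hx
  have xB2 := mul_le_mul_of_nonneg_left hB2 hx
  have yB1 := mul_le_mul_of_nonneg_left hB1 hy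
  have yB2 := mul_le_mul_of_nonneg_left hB2 hy
  have xa1 := mul_le_mul_of_nonneg_left ha1 hx
  have xa2 := mul_le_mul_of_nonneg_left ha2 hx
  have ya1 := mul_le_mul_of_nonneg_left ha1 hy
  have ya2 := mul_le_mul_of_nonneg_left ha2 hy
  have xb1 := mul_le_mul_of_nonneg_left hb1 hx
  have xb2 := mul_le_mul_of_nonneg_left hb2 hx
  have yb1 := mul_le_mul_of_nonneg_left hb1 hy
  have yb2 := mul_le_mul_of_nonneg_left hb2 hy
  have hN : 0 ≤ x ^ 2 + y ^ 2 := by positivity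
  have nA1 := mul_le_mul_of_nonneg_left hA1 hN
  have nA2 := mul_le_mul_of_nonneg_left hA2 hN
  have nB1 := mul_le_mul_of_nonneg_left hB1 hN
  have nB2 := mul_le_mul_of_nonneg_left hB2 hN
  have e1 : x * a + y * b + (x ^ 2 + y ^ 2) * A = 0 := by linear_combination x * hre + y * him
  have e2 : x * b - y * a + (x ^ 2 + y ^ 2) * B = 0 := by linear_combination x * him - y * hre
  fin_cases i <;> simp [octagonSupport] <;> linarith

/-- A finite family of continuous functions that is nonnegative at `1` but not at `0` becomes
critical in between. -/
lemma exists_critical_parameter {ι : Type*} [Fintype ι] [Nonempty ι] {h : ι → ℝ → ℝ}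
    (hc : ∀ i, Continuous (h i)) (h1 : ∀ i, 0 ≤ h i 1) (h0 : ¬ ∀ i, 0 ≤ h i 0) :
    ∃ t ∈ Set.Ioc (0 : ℝ) 1, (∀ i, 0 ≤ h i t) ∧ ∃ i, h i t = 0 := by
  set μ : ℝ → ℝ := fun t => Finset.univ.inf' Finset.univ_nonempty fun i => h i t with hμ
  have hcont : Continuous μ :=
    Continuous.finset_inf'_apply Finset.univ_nonempty fun i _ => hc i
  have hμ1 : 0 ≤ μ 1 := Finset.le_inf' _ _ fun i _ => h1 i
  push Not at h0
  obtain ⟨j, hj⟩ := h0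
  have hμ0 : μ 0 < 0 := (Finset.inf'_le _ (Finset.mem_univ j)).trans_lt hj
  obtain ⟨t, ht, ht0⟩ := intermediate_value_Icc zero_le_one hcont.continuousOn
    (Set.mem_Icc.2 ⟨hμ0.le, hμ1⟩)
  refine ⟨t, ⟨lt_of_le_of_ne ht.1 ?_, ht.2⟩, fun i => ?_, ?_⟩
  · rintro rfl
    exact hμ0.ne ht0
  · rw [← ht0]
    exact Finset.inf'_le _ (Finset.mem_univ i)
  · obtain ⟨i, -, hi⟩ := Finset.exists_mem_eq_inf' Finset.univ_nonempty fun i => h i t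
    exact ⟨i, by rw [← hi]; exact ht0⟩

lemma nonpos_of_pos_mul_eq_neg {x w s : ℝ} (hx : 0 < x) (hs : 0 ≤ s) (h : x * w = -s) : w ≤ 0 :=
  nonpos_of_mul_nonpos_right (h.trans_le (neg_nonpos.2 hs)) hx

lemma nonneg_of_pos_mul_eq {x w s : ℝ} (hx : 0 < x) (hs : 0 ≤ s) (h : x * w = s) : 0 ≤ w :=
  nonneg_of_mul_nonneg_right (hs.trans_eq h.symm) hx

/-- If the eight critical vertex combinations are stable, the origin is not on the boundary of
the octagon. -/
lemma octagon_boundary_avoids_zero {a₁ a₂ b₁ b₂ A₁ A₂ B₁ B₂ : ℝ[X]} {c : ℂ} {ω : ℝ}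
    (hx : 0 < c.re) (hy : 0 < c.im)
    (h1111 : IsStableNonconst (combination c (evenOdd A₁ B₁) (evenOdd a₁ b₁)))
    (h1212 : IsStableNonconst (combination c (evenOdd A₁ B₂) (evenOdd a₁ b₂)))
    (h2222 : IsStableNonconst (combination c (evenOdd A₂ B₂) (evenOdd a₂ b₂)))
    (h2121 : IsStableNonconst (combination c (evenOdd A₂ B₁) (evenOdd a₂ b₁)))
    (h1112 : IsStableNonconst (combination c (evenOdd A₁ B₂) (evenOdd a₁ b₁)))
    (h1222 : IsStableNonconst (combination c (evenOdd A₂ B₂) (evenOdd a₁ b₂)))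
    (h2221 : IsStableNonconst (combination c (evenOdd A₂ B₁) (evenOdd a₂ b₂)))
    (h2111 : IsStableNonconst (combination c (evenOdd A₁ B₁) (evenOdd a₂ b₁)))
    {i : Fin 8}
    (hnonneg : ∀ j, 0 ≤ octagonSupport (a₁.eval (-ω ^ 2)) (a₂.eval (-ω ^ 2))
      (ω * b₁.eval (-ω ^ 2)) (ω * b₂.eval (-ω ^ 2)) (A₁.eval (-ω ^ 2)) (A₂.eval (-ω ^ 2))
      (ω * B₁.eval (-ω ^ 2)) (ω * B₂.eval (-ω ^ 2)) c.re c.im j)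
    (hzero : octagonSupport (a₁.eval (-ω ^ 2)) (a₂.eval (-ω ^ 2))
      (ω * b₁.eval (-ω ^ 2)) (ω * b₂.eval (-ω ^ 2)) (A₁.eval (-ω ^ 2)) (A₂.eval (-ω ^ 2))
      (ω * B₁.eval (-ω ^ 2)) (ω * B₂.eval (-ω ^ 2)) c.re c.im i = 0) : False := by
  have hc : c ≠ 0 := by rintro rfl; simp at hx
  have hc' : (starRingEnd ℂ) c ≠ 0 := (_root_.map_ne_zero _).2 hc
  have hI : -Complex.I ≠ 0 := neg_ne_zero.2 Complex.I_ne_zero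
  have s0 := hnonneg 0
  have s1 := hnonneg 1
  have s2 := hnonneg 2
  have s3 := hnonneg 3
  have s4 := hnonneg 4
  have s5 := hnonneg 5
  have s6 := hnonneg 6
  have s7 := hnonneg 7
  -- These pairs are the endpoints of the eight edges; each multiplier rotates its edge into the
  -- real direction.
  have e0 := h2121.edge h2221 hI (ω := ω)
  have e1 := h1112.edge h1212 hI (ω := ω)
  have e2 := h1111.edge h2111 one_ne_zero (ω := ω)
  have e3 := h1222.edge h2222 one_ne_zero (ω := ω)
  have e4 := h1111.edge h1112 (mul_ne_zero hI hc') (ω := ω)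
  have e5 := h2221.edge h2222 (mul_ne_zero hI hc') (ω := ω)
  have e6 := h2111.edge h2121 hc' (ω := ω)
  have e7 := h1212.edge h1222 hc' (ω := ω)
  simp only [eval_combination_evenOdd, Complex.mul_re, Complex.mul_im, Complex.neg_re,
    Complex.neg_im, Complex.I_re, Complex.I_im, Complex.one_re, Complex.one_im, Complex.conj_re,
    Complex.conj_im] at e0 e1 e2 e3 e4 e5 e6 e7
  clear h1111 h1212 h2222 h2121 h1112 h1222 h2221 h2111 hnonneg
  generalize c.re = x at *
  generalize c.im = y at *
  generalize -ω ^ 2 = u at *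
  generalize a₁.eval u = a1 at *
  generalize a₂.eval u = a2 at *
  generalize A₁.eval u = A1 at *
  generalize A₂.eval u = A2 at *
  generalize ω * b₁.eval u = b1 at *
  generalize ω * b₂.eval u = b2 at *
  generalize ω * B₁.eval u = B1 at *
  generalize ω * B₂.eval u = B2 at *
  have hN : 0 ≤ x ^ 2 + y ^ 2 := by positivity
  simp only [octagonSupport, Fin.isValue, Matrix.cons_val] at s0 s1 s2 s3 s4 s5 s6 s7
  fin_cases i <;> simp only [octagonSupport, Fin.isValue, Fin.zero_eta, Fin.mk_one,
    Fin.reduceFinMk, Matrix.cons_val] at hzero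
  -- The origin is on the line carrying the edge. The supports of the two adjacent edges, rescaled
  -- by `x` or `y`, place it between the endpoints. The other seven cases are alike, with an extra
  -- factor `x ^ 2 + y ^ 2` for the edges parallel to `c` or `ic`.
  · refine e0 (fun w => by ring) ?_ (nonpos_of_pos_mul_eq_neg hx s6 ?_)
      (nonneg_of_pos_mul_eq hy s5 ?_)
    exacts [by linear_combination -hzero, by linear_combination y * hzero,
      by linear_combination -x * hzero]
  · refine e1 (fun w => by ring) ?_ (nonpos_of_pos_mul_eq_neg hy s4 ?_)
      (nonneg_of_pos_mul_eq hx s7 ?_)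
    exacts [by linear_combination hzero, by linear_combination x * hzero,
      by linear_combination -y * hzero]
  · refine e2 (fun w => by ring) ?_ (nonpos_of_pos_mul_eq_neg hx s4 ?_)
      (nonneg_of_pos_mul_eq hy s6 ?_)
    exacts [by linear_combination -hzero, by linear_combination y * hzero,
      by linear_combination -x * hzero]
  · refine e3 (fun w => by ring) ?_ (nonpos_of_pos_mul_eq_neg hy s7 ?_)
      (nonneg_of_pos_mul_eq hx s5 ?_)
    exacts [by linear_combination hzero, by linear_combination x * hzero,
      by linear_combination -y * hzero]
  · refine e4 (fun w => by ring) ?_ (nonpos_of_pos_mul_eq_neg hx (mul_nonneg hN s2) ?_)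
      (nonneg_of_pos_mul_eq hy (mul_nonneg hN s1) ?_)
    exacts [by linear_combination hzero, by linear_combination y * hzero,
      by linear_combination -x * hzero]
  · refine e5 (fun w => by ring) ?_ (nonpos_of_pos_mul_eq_neg hy (mul_nonneg hN s0) ?_)
      (nonneg_of_pos_mul_eq hx (mul_nonneg hN s3) ?_)
    exacts [by linear_combination -hzero, by linear_combination x * hzero,
      by linear_combination -y * hzero]
  · refine e6 (fun w => by ring) ?_ (nonpos_of_pos_mul_eq_neg hy (mul_nonneg hN s2) ?_)
      (nonneg_of_pos_mul_eq hx (mul_nonneg hN s0) ?_)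
    exacts [by linear_combination -hzero, by linear_combination x * hzero,
      by linear_combination -y * hzero]
  · refine e7 (fun w => by ring) ?_ (nonpos_of_pos_mul_eq_neg hx (mul_nonneg hN s1) ?_)
      (nonneg_of_pos_mul_eq hy (mul_nonneg hN s3) ?_)
    exacts [by linear_combination hzero, by linear_combination y * hzero,
      by linear_combination -x * hzero]

/-- If the eight critical vertex combinations are stable for all multipliers between `c` and its
real part, and the rectangle for the real part of `c` misses the origin, then `c * f + g` does not
vanish for all values `f`, `g` in the two rectangles. -/
lemma octagon_avoids_zero {a₁ a₂ b₁ b₂ A₁ A₂ B₁ B₂ : ℝ[X]} {c : ℂ} {ω : ℝ}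
    (hx : 0 < c.re) (hy : 0 ≤ c.im)
    (hV : ∀ z : ℂ, z.re = c.re → 0 < z.im → z.im ≤ c.im →
      IsStableNonconst (combination z (evenOdd A₁ B₁) (evenOdd a₁ b₁)) ∧
      IsStableNonconst (combination z (evenOdd A₁ B₂) (evenOdd a₁ b₂)) ∧
      IsStableNonconst (combination z (evenOdd A₂ B₂) (evenOdd a₂ b₂)) ∧
      IsStableNonconst (combination z (evenOdd A₂ B₁) (evenOdd a₂ b₁)) ∧
      IsStableNonconst (combination z (evenOdd A₁ B₂) (evenOdd a₁ b₁)) ∧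
      IsStableNonconst (combination z (evenOdd A₂ B₂) (evenOdd a₁ b₂)) ∧
      IsStableNonconst (combination z (evenOdd A₂ B₁) (evenOdd a₂ b₂)) ∧
      IsStableNonconst (combination z (evenOdd A₁ B₁) (evenOdd a₂ b₁)))
    (hR : ¬ ((0 : ℝ) ∈ Set.uIcc (a₁.eval (-ω ^ 2) + c.re * A₁.eval (-ω ^ 2))
        (a₂.eval (-ω ^ 2) + c.re * A₂.eval (-ω ^ 2)) ∧
      (0 : ℝ) ∈ Set.uIcc (ω * (b₁.eval (-ω ^ 2) + c.re * B₁.eval (-ω ^ 2)))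
        (ω * (b₂.eval (-ω ^ 2) + c.re * B₂.eval (-ω ^ 2)))))
    {a b A B : ℝ} (ha : a ∈ Set.Icc (a₁.eval (-ω ^ 2)) (a₂.eval (-ω ^ 2)))
    (hb : b ∈ Set.Icc (ω * b₁.eval (-ω ^ 2)) (ω * b₂.eval (-ω ^ 2)))
    (hA : A ∈ Set.Icc (A₁.eval (-ω ^ 2)) (A₂.eval (-ω ^ 2)))
    (hB : B ∈ Set.Icc (ω * B₁.eval (-ω ^ 2)) (ω * B₂.eval (-ω ^ 2))) :
    c * ⟨A, B⟩ + ⟨a, b⟩ ≠ 0 := by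
  intro h0
  have hre := congrArg Complex.re h0
  have him := congrArg Complex.im h0
  simp only [Complex.add_re, Complex.mul_re, Complex.add_im, Complex.mul_im, Complex.zero_re,
    Complex.zero_im] at hre him
  have h1 := octagonSupport_nonneg hx.le hy ha hb hA hB
    (by linear_combination hre) (by linear_combination him)
  -- At imaginary part `0`, the first four supports alone describe the rectangle excluded by `hR`.
  have h2 : ¬ ∀ i, 0 ≤ octagonSupport (a₁.eval (-ω ^ 2)) (a₂.eval (-ω ^ 2))
      (ω * b₁.eval (-ω ^ 2)) (ω * b₂.eval (-ω ^ 2)) (A₁.eval (-ω ^ 2)) (A₂.eval (-ω ^ 2))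
      (ω * B₁.eval (-ω ^ 2)) (ω * B₂.eval (-ω ^ 2)) c.re 0 i := by
    refine fun h => hR ⟨?_, ?_⟩
    · have s0 := h 0
      have s1 := h 1
      simp only [octagonSupport, Fin.isValue, Matrix.cons_val] at s0 s1
      refine Set.mem_uIcc_of_le ?_ ?_ <;> linarith
    · have s2 := h 2
      have s3 := h 3
      simp only [octagonSupport, Fin.isValue, Matrix.cons_val] at s2 s3
      refine Set.mem_uIcc_of_le ?_ ?_ <;> linarith
  have hpos : 0 < c.im := lt_of_le_of_ne hy fun h => h2 (by rwa [← h] at h1)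
  obtain ⟨t, ht, hnonneg, i, hi⟩ := exists_critical_parameter
    (h := fun i t => octagonSupport (a₁.eval (-ω ^ 2)) (a₂.eval (-ω ^ 2))
      (ω * b₁.eval (-ω ^ 2)) (ω * b₂.eval (-ω ^ 2)) (A₁.eval (-ω ^ 2)) (A₂.eval (-ω ^ 2))
      (ω * B₁.eval (-ω ^ 2)) (ω * B₂.eval (-ω ^ 2)) c.re (t * c.im) i)
    (fun i => by
      fin_cases i <;> simp only [octagonSupport, Fin.isValue, Fin.zero_eta, Fin.mk_one,
        Fin.reduceFinMk, Matrix.cons_val] <;> fun_prop)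
    (fun i => by simpa only [one_mul] using h1 i)
    (by simpa only [zero_mul] using h2)
  have hz : 0 < t * c.im := mul_pos ht.1 hpos
  obtain ⟨v1, v2, v3, v4, v5, v6, v7, v8⟩ := hV ⟨c.re, t * c.im⟩ rfl hz
    (mul_le_of_le_one_left hy ht.2)
  exact octagon_boundary_avoids_zero (c := ⟨c.re, t * c.im⟩) hx hz v1 v2 v3 v4 v5 v6 v7 v8
    hnonneg hi

/-! ### Interval families and their vertex polynomials -/

lemma sum_range_succ_even_odd {M : Type*} [AddCommMonoid M] (F : ℕ → M) (n : ℕ) :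
    ∑ i ∈ Finset.range (n + 1), F i =
      ∑ k ∈ Finset.range (n / 2 + 1), F (2 * k) +
        ∑ k ∈ Finset.range ((n + 1) / 2), F (2 * k + 1) := by
  induction n with
  | zero => simp
  | succ n ih =>
    rw [Finset.sum_range_succ, ih]
    rcases Nat.even_or_odd' n with ⟨k, rfl | rfl⟩
    · have h1 : (2 * k + 1) / 2 = k := by omega
      have h2 : 2 * k / 2 = k := by omega
      have h3 : (2 * k + 1 + 1) / 2 = k + 1 := by omega
      rw [h1, h2, h3, Finset.sum_range_succ (fun k => F (2 * k + 1)), add_assoc]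
    · have h1 : (2 * k + 1) / 2 = k := by omega
      have h2 : (2 * k + 1 + 1) / 2 = k + 1 := by omega
      have h3 : (2 * k + 1 + 1 + 1) / 2 = k + 1 := by omega
      rw [h1, h2, h3, Finset.sum_range_succ (fun k => F (2 * k)) (k + 1), add_right_comm,
        show 2 * (k + 1) = 2 * k + 1 + 1 by ring]

/-- The even part, in `u = s ^ 2`, of `∑ i ≤ n, q i * s ^ i`. -/
noncomputable def evenPart (n : ℕ) (q : ℕ → ℝ) : ℝ[X] :=
  ∑ k ∈ Finset.range (n / 2 + 1), C (q (2 * k)) * X ^ k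

/-- The odd part, in `u = s ^ 2`, of `∑ i ≤ n, q i * s ^ i`, divided by `s`. -/
noncomputable def oddPart (n : ℕ) (q : ℕ → ℝ) : ℝ[X] :=
  ∑ k ∈ Finset.range ((n + 1) / 2), C (q (2 * k + 1)) * X ^ k

lemma sum_eq_evenOdd (n : ℕ) (q : ℕ → ℝ) :
    ∑ i ∈ Finset.range (n + 1), C (q i) * X ^ i = evenOdd (evenPart n q) (oddPart n q) := by
  rw [sum_range_succ_even_odd, evenOdd, evenPart, oddPart, comp, comp, eval₂_finsetSum,
    eval₂_finsetSum, Finset.mul_sum]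
  congr 1 <;> refine Finset.sum_congr rfl fun k _ => ?_
  · rw [eval₂_mul, eval₂_C, eval₂_X_pow, ← pow_mul]
  · rw [eval₂_mul, eval₂_C, eval₂_X_pow, ← pow_mul]
    ring

/-- The coefficients of the Kharitonov vertex polynomials. -/
noncomputable def kharitonovCoeff (lo hi : ℕ → ℝ) (i j l : ℕ) : ℝ :=
  if Odd (l / 2 + if Even l then i else j) then lo l else hi l

lemma extremeEven_eq (n : ℕ) (lo hi : ℕ → ℝ) (i j : ℕ) :
    extremeEven n lo hi i = evenPart n (kharitonovCoeff lo hi i j) := by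
  refine Finset.sum_congr rfl fun k _ => ?_
  simp [kharitonovCoeff]

lemma extremeOdd_eq (n : ℕ) (lo hi : ℕ → ℝ) (i j : ℕ) :
    extremeOdd n lo hi j = oddPart n (kharitonovCoeff lo hi i j) := by
  refine Finset.sum_congr rfl fun k _ => ?_
  have h1 : (2 * k + 1) / 2 = k := by omega
  simp [kharitonovCoeff, h1]

lemma kharitonov_eq_evenOdd (n : ℕ) (lo hi : ℕ → ℝ) (i j : ℕ) :
    kharitonov n lo hi i j = evenOdd (extremeEven n lo hi i) (extremeOdd n lo hi j) := rfl

lemma kharitonov_mem_intervalFamily {n : ℕ} {lo hi : ℕ → ℝ} (h : ∀ i ≤ n, lo i ≤ hi i)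
    (i j : ℕ) : kharitonov n lo hi i j ∈ intervalFamily n lo hi := by
  refine ⟨kharitonovCoeff lo hi i j, fun l hl => ?_, ?_⟩
  · unfold kharitonovCoeff
    split_ifs <;> simp [h l hl]
  · rw [sum_eq_evenOdd, kharitonov_eq_evenOdd, extremeEven_eq n lo hi i j,
      extremeOdd_eq n lo hi i j]

/-- For `u ≤ 0` the sign of `u ^ k` alternates with `k`, so alternating the endpoints makes every
term extremal at once. -/
lemma alternating_mul_pow_le {lo hi q u : ℝ} (hq : q ∈ Set.Icc lo hi) (hu : u ≤ 0) (k : ℕ) :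
    q * u ^ k ∈ Set.Icc ((if Odd (k + 1) then lo else hi) * u ^ k)
      ((if Odd (k + 2) then lo else hi) * u ^ k) := by
  rcases Nat.even_or_odd k with hk | hk
  · have h1 : Odd (k + 1) := hk.add_one
    have h2 : ¬ Odd (k + 2) := Nat.not_odd_iff_even.2 (hk.add even_two)
    rw [if_pos h1, if_neg h2]
    exact ⟨mul_le_mul_of_nonneg_right hq.1 (hk.pow_nonneg u),
      mul_le_mul_of_nonneg_right hq.2 (hk.pow_nonneg u)⟩
  · have h1 : ¬ Odd (k + 1) := Nat.not_odd_iff_even.2 hk.add_one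
    have h2 : Odd (k + 2) := hk.add_even even_two
    rw [if_neg h1, if_pos h2]
    exact ⟨mul_le_mul_of_nonpos_right hq.2 (hk.pow_nonpos hu),
      mul_le_mul_of_nonpos_right hq.1 (hk.pow_nonpos hu)⟩

lemma eval_evenPart_mem {n : ℕ} {lo hi q : ℕ → ℝ} (hq : ∀ i ≤ n, q i ∈ Set.Icc (lo i) (hi i))
    {u : ℝ} (hu : u ≤ 0) : (evenPart n q).eval u ∈
      Set.Icc ((extremeEven n lo hi 1).eval u) ((extremeEven n lo hi 2).eval u) := by
  simp only [evenPart, extremeEven, eval_finsetSum, eval_mul, eval_C, eval_pow, eval_X]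
  have h : ∀ k ∈ Finset.range (n / 2 + 1), 2 * k ≤ n := fun k hk => by
    have := Finset.mem_range.1 hk; omega
  exact ⟨Finset.sum_le_sum fun k hk => (alternating_mul_pow_le (hq _ (h k hk)) hu k).1,
    Finset.sum_le_sum fun k hk => (alternating_mul_pow_le (hq _ (h k hk)) hu k).2⟩

lemma eval_oddPart_mem {n : ℕ} {lo hi q : ℕ → ℝ} (hq : ∀ i ≤ n, q i ∈ Set.Icc (lo i) (hi i))
    {u : ℝ} (hu : u ≤ 0) : (oddPart n q).eval u ∈
      Set.Icc ((extremeOdd n lo hi 1).eval u) ((extremeOdd n lo hi 2).eval u) := by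
  simp only [oddPart, extremeOdd, eval_finsetSum, eval_mul, eval_C, eval_pow, eval_X]
  have h : ∀ k ∈ Finset.range ((n + 1) / 2), 2 * k + 1 ≤ n := fun k hk => by
    have := Finset.mem_range.1 hk; omega
  exact ⟨Finset.sum_le_sum fun k hk => (alternating_mul_pow_le (hq _ (h k hk)) hu k).1,
    Finset.sum_le_sum fun k hk => (alternating_mul_pow_le (hq _ (h k hk)) hu k).2⟩

lemma natDegree_le_of_mem_intervalFamily {n : ℕ} {lo hi : ℕ → ℝ} {p : ℝ[X]}
    (hp : p ∈ intervalFamily n lo hi) : p.natDegree ≤ n := by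
  obtain ⟨q, -, rfl⟩ := hp
  exact natDegree_sum_le_of_forall_le _ _ fun i hi =>
    (natDegree_C_mul_X_pow_le _ _).trans (Nat.lt_succ_iff.1 (Finset.mem_range.1 hi))

lemma coeff_mem_of_mem_intervalFamily {n : ℕ} {lo hi : ℕ → ℝ} {p : ℝ[X]}
    (hp : p ∈ intervalFamily n lo hi) : p.coeff n ∈ Set.Icc (lo n) (hi n) := by
  obtain ⟨q, hq, rfl⟩ := hp
  have : (∑ i ∈ Finset.range (n + 1), C (q i) * X ^ i).coeff n = q n := by
    simp
  rw [this]
  exact hq n le_rfl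

lemma hurwitz_iff_isStable {p : ℝ[X]} : Hurwitz p ↔ IsStable (complexify p) := by
  simp only [Hurwitz, IsStable, complexify, eval_map_algebraMap]

lemma exists_sign {a b : ℝ} (h : (0 : ℝ) ∉ Set.Icc a b) :
    ∃ σ : ℝ, ∀ x ∈ Set.Icc a b, 0 < σ * x := by
  rcases lt_or_ge 0 a with ha | ha
  · exact ⟨1, fun x hx => by linarith [hx.1]⟩
  · have hb : b < 0 := not_le.1 fun hb => h ⟨ha, hb⟩
    exact ⟨-1, fun x hx => by linarith [hx.2]⟩

lemma coeff_add_of_natDegree_lt {f g : ℝ[X]} {n : ℕ} (hg : g.natDegree < n) :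
    (f + g).coeff n = f.coeff n := by
  rw [coeff_add, coeff_eq_zero_of_natDegree_lt hg, add_zero]

/-! ### Small gain: stability under complex multipliers -/

section Feedback

variable {f g : ℝ[X]} {n : ℕ}

lemma norm_smul_sub_one_lt {γ : ℝ} (hγ : 1 < γ) {c : ℂ} (hc : ‖c - 1‖ ≤ 1 / γ) {a b : ℂ}
    (hab : ‖a‖ < γ * ‖b‖) {t : ℝ} (ht : t ∈ Set.Icc (0 : ℝ) 1) : ‖(t : ℂ) * (c - 1) * a‖ < ‖b‖ := by
  have hγ0 : 0 < γ := by linarith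
  rw [norm_mul, norm_mul, Complex.norm_real, Real.norm_of_nonneg ht.1]
  calc t * ‖c - 1‖ * ‖a‖ ≤ 1 * (1 / γ) * ‖a‖ :=
        mul_le_mul_of_nonneg_right (mul_le_mul ht.2 hc (norm_nonneg _) zero_le_one) (norm_nonneg _)
    _ = ‖a‖ / γ := by ring
    _ < ‖b‖ := by rw [div_lt_iff₀ hγ0]; linarith

/-- Robustness of a stable loop with sensitivity less than `γ` against multipliers in the disc of
radius `1 / γ` about `1`. -/
lemma isStableNonconst_combination (hn : 0 < n) (hs : IsStable (complexify (f + g)))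
    (hf : f.natDegree ≤ n) (hfn : f.coeff n ≠ 0) (hg : g.natDegree < n) {γ : ℝ} (hγ : 1 < γ)
    (hF : ∀ ω : ℝ, ‖(complexify f).eval (ω * Complex.I)‖ <
      γ * ‖(complexify (f + g)).eval (ω * Complex.I)‖)
    {c : ℂ} (hc : ‖c - 1‖ ≤ 1 / γ) : IsStableNonconst (combination c f g) := by
  have hγ0 : 0 < γ := by linarith
  have hcoeff : (combination c f g).coeff n = c * f.coeff n := by
    simp [combination, complexify, coeff_eq_zero_of_natDegree_lt hg]
  have hcoeff' : (complexify (f + g)).coeff n = f.coeff n := by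
    rw [complexify, coeff_map, coeff_add_of_natDegree_lt hg, Complex.coe_algebraMap]
  have hdeg : (combination c f g).natDegree ≤ n :=
    natDegree_add_le_of_degree_le
      ((natDegree_C_mul_le _ _).trans ((natDegree_complexify f).trans_le hf))
      ((natDegree_complexify g).trans_le hg.le)
  have hlead : ∀ t ∈ Set.Icc (0 : ℝ) 1, (1 - t) * (complexify (f + g)).coeff n +
      t * (combination c f g).coeff n ≠ 0 := by
    intro t ht h0
    -- The case `a = b = 1` says `|t (c - 1)| < 1`, so `1 + t (c - 1)` cannot vanish and the degree
    -- stays `n`.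
    have h1 := norm_smul_sub_one_lt hγ hc (a := 1) (b := 1)
      (by rw [norm_one, mul_one]; exact hγ) ht
    rw [hcoeff, hcoeff'] at h0
    have h2 : (1 + t * (c - 1)) * (f.coeff n : ℂ) = 0 := by linear_combination h0
    have h3 := (mul_eq_zero.1 h2).resolve_right (by exact_mod_cast hfn)
    have h4 : (t : ℂ) * (c - 1) * 1 = -1 := by linear_combination h3
    rw [h4, norm_neg] at h1
    exact lt_irrefl _ h1
  refine ⟨hs.of_segment (n := n) ((natDegree_complexify _).trans_le
    (natDegree_add_le_of_degree_le hf hg.le)) hdeg hlead fun t ht ω h0 => ?_, ?_⟩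
  · have h1 := norm_smul_sub_one_lt hγ hc (hF ω) ht
    have h2 : (t : ℂ) * (c - 1) * (complexify f).eval (ω * Complex.I) =
        -(complexify (f + g)).eval (ω * Complex.I) := by
      rw [eval_combination] at h0
      have h3 : (complexify (f + g)).eval (ω * Complex.I) =
          (complexify f).eval (ω * Complex.I) + (complexify g).eval (ω * Complex.I) := by
        simp only [complexify, Polynomial.map_add, eval_add]
      rw [h3] at h0 ⊢
      linear_combination h0
    rw [h2, norm_neg] at h1
    exact lt_irrefl _ h1
  · have h1 := hlead 1 (Set.right_mem_Icc.2 zero_le_one)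
    rw [natDegree_eq_of_le_of_coeff_ne_zero hdeg (by simpa using h1)]
    exact hn

end Feedback

/-! ### From the vertices to all members of the families -/

/-- Kharitonov's theorem for the sum of two interval families. -/
lemma stableOfDegree_add_of_mem {m n : ℕ} (hmn : m < n) {bLo bHi aLo aHi : ℕ → ℝ} {σ : ℝ}
    (hσ : ∀ x ∈ Set.Icc (aLo n) (aHi n), 0 < σ * x)
    (hV : ∀ i ∈ ({1, 2} : Set ℕ), ∀ j ∈ ({1, 2} : Set ℕ),
      StableOfDegree n σ (kharitonov n aLo aHi i j + kharitonov m bLo bHi i j))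
    {f g : ℝ[X]} (hg : g ∈ intervalFamily m bLo bHi) (hf : f ∈ intervalFamily n aLo aHi) :
    StableOfDegree n σ (f + g) := by
  have hgd := (natDegree_le_of_mem_intervalFamily hg).trans_lt hmn
  have hdeg : (f + g).natDegree ≤ n :=
    natDegree_add_le_of_degree_le (natDegree_le_of_mem_intervalFamily hf) hgd.le
  have hc : 0 < σ * (f + g).coeff n := by
    rw [coeff_add_of_natDegree_lt hgd]
    exact hσ _ (coeff_mem_of_mem_intervalFamily hf)
  obtain ⟨q, hq, rfl⟩ := hf
  obtain ⟨r, hr, rfl⟩ := hg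
  simp only [kharitonov_eq_evenOdd, evenOdd_add] at hV
  rw [sum_eq_evenOdd, sum_eq_evenOdd, evenOdd_add] at hdeg hc ⊢
  refine StableOfDegree.of_rectangle (Nat.zero_lt_of_lt hmn) (hV 1 (by simp) 1 (by simp))
    (hV 1 (by simp) 2 (by simp)) (hV 2 (by simp) 1 (by simp)) (hV 2 (by simp) 2 (by simp))
    (fun u hu => ?_) (fun u hu => ?_) hdeg hc
  · have h1 := eval_evenPart_mem hq hu
    have h2 := eval_evenPart_mem hr hu
    rw [eval_add, eval_add, eval_add]
    exact ⟨add_le_add h1.1 h2.1, add_le_add h1.2 h2.2⟩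
  · have h1 := eval_oddPart_mem hq hu
    have h2 := eval_oddPart_mem hr hu
    rw [eval_add, eval_add, eval_add]
    exact ⟨add_le_add h1.1 h2.1, add_le_add h1.2 h2.2⟩

lemma complexify_C_mul_add (x : ℝ) (f g : ℝ[X]) :
    complexify (C x * f + g) = combination x f g := by
  simp [complexify, combination]

lemma mul_mem_Icc_of_nonneg {w x a b : ℝ} (hw : 0 ≤ w) (hx : x ∈ Set.Icc a b) :
    w * x ∈ Set.Icc (w * a) (w * b) :=
  ⟨mul_le_mul_of_nonneg_left hx.1 hw, mul_le_mul_of_nonneg_left hx.2 hw⟩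

lemma mul_mem_Icc_of_nonpos {w x a b : ℝ} (hw : w ≤ 0) (hx : x ∈ Set.Icc a b) :
    w * x ∈ Set.Icc (w * b) (w * a) :=
  ⟨mul_le_mul_of_nonpos_left hx.2 hw, mul_le_mul_of_nonpos_left hx.1 hw⟩

/-- Both polynomials have real coefficients; this reduces multipliers with negative imaginary part
to the opposite frequency. -/
lemma eval_combination_neg_conj (c : ℂ) (q r : ℕ → ℝ) (m n : ℕ) (ω : ℝ) :
    (combination ((starRingEnd ℂ) c) (evenOdd (evenPart n q) (oddPart n q))
      (evenOdd (evenPart m r) (oddPart m r))).eval ((-ω : ℝ) * Complex.I) =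
    (starRingEnd ℂ) ((combination c (evenOdd (evenPart n q) (oddPart n q))
      (evenOdd (evenPart m r) (oddPart m r))).eval (ω * Complex.I)) := by
  rw [eval_combination_evenOdd, eval_combination_evenOdd]
  apply Complex.ext
  · simp only [Complex.conj_re, Complex.conj_im, neg_sq]; ring
  · simp only [Complex.conj_re, Complex.conj_im, neg_sq]; ring

section Vertices

variable {m n : ℕ} {bLo bHi aLo aHi : ℕ → ℝ} {σ ρ : ℝ}

lemma combination_avoids_zero_of_im_nonneg (hmn : m < n)
    (hσ : ∀ x ∈ Set.Icc (aLo n) (aHi n), 0 < σ * x) (ha : ∀ i ≤ n, aLo i ≤ aHi i)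
    (hb : ∀ i ≤ m, bLo i ≤ bHi i) (hρ : ρ < 1)
    (hV : ∀ i₁ j₁ i₂ j₂ : ℕ, (i₁, j₁, i₂, j₂) ∈ criticalIndices → ∀ c : ℂ, ‖c - 1‖ ≤ ρ →
      IsStableNonconst (combination c (kharitonov n aLo aHi i₂ j₂) (kharitonov m bLo bHi i₁ j₁)))
    {q r : ℕ → ℝ} (hq : ∀ i ≤ n, q i ∈ Set.Icc (aLo i) (aHi i))
    (hr : ∀ i ≤ m, r i ∈ Set.Icc (bLo i) (bHi i)) {c : ℂ} (hc : ‖c - 1‖ ≤ ρ) (hy : 0 ≤ c.im)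
    (ω : ℝ) : (combination c (evenOdd (evenPart n q) (oddPart n q))
      (evenOdd (evenPart m r) (oddPart m r))).eval (ω * Complex.I) ≠ 0 := by
  have hn : 0 < n := Nat.zero_lt_of_lt hmn
  have hre : |c.re - 1| ≤ ‖c - 1‖ := by simpa using Complex.abs_re_le_norm (c - 1)
  have hx : 0 < c.re := by linarith [(abs_le.1 hre).1]
  have hu : -ω ^ 2 ≤ 0 := by nlinarith [sq_nonneg ω]
  -- The disc is centred on the real axis, so moving `c` vertically towards that axis stays inside
  -- it.
  have hball : ∀ z : ℂ, z.re = c.re → 0 < z.im → z.im ≤ c.im → ‖z - 1‖ ≤ ρ := by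
    intro z h1 h2 h3
    refine le_trans ?_ hc
    rw [Complex.norm_def, Complex.norm_def]
    refine Real.sqrt_le_sqrt ?_
    simp only [Complex.normSq_apply, Complex.sub_re, Complex.sub_im, Complex.one_re,
      Complex.one_im, h1, sub_zero]
    nlinarith
  -- For the real multiplier `Re c`, the diagonal pairs give the four vertices of the family of all
  -- `Re c * f + g`.
  have hdiag : ∀ i j : ℕ, (i, j, i, j) ∈ criticalIndices →
      StableOfDegree n σ (evenOdd (C c.re * extremeEven n aLo aHi i + extremeEven m bLo bHi i)
        (C c.re * extremeOdd n aLo aHi j + extremeOdd m bLo bHi j)) := by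
    intro i j hij
    rw [← evenOdd_add, ← C_mul_evenOdd, ← kharitonov_eq_evenOdd, ← kharitonov_eq_evenOdd]
    have hf := kharitonov_mem_intervalFamily ha i j
    have hg := kharitonov_mem_intervalFamily hb i j
    have hgd := (natDegree_le_of_mem_intervalFamily hg).trans_lt hmn
    refine ⟨?_, natDegree_add_le_of_degree_le
      ((natDegree_C_mul_le _ _).trans (natDegree_le_of_mem_intervalFamily hf)) hgd.le, ?_⟩
    · rw [complexify_C_mul_add]
      refine (hV i j i j hij c.re ?_).1
      rw [← Complex.ofReal_one, ← Complex.ofReal_sub, Complex.norm_real]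
      exact hre.trans hc
    · rw [coeff_add_of_natDegree_lt hgd, coeff_C_mul, mul_left_comm]
      exact mul_pos hx (hσ _ (coeff_mem_of_mem_intervalFamily hf))
  have hR : ¬ ((0 : ℝ) ∈ Set.uIcc
        ((extremeEven m bLo bHi 1).eval (-ω ^ 2) + c.re * (extremeEven n aLo aHi 1).eval (-ω ^ 2))
        ((extremeEven m bLo bHi 2).eval (-ω ^ 2) +
          c.re * (extremeEven n aLo aHi 2).eval (-ω ^ 2)) ∧
      (0 : ℝ) ∈ Set.uIcc
        (ω * ((extremeOdd m bLo bHi 1).eval (-ω ^ 2) +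
          c.re * (extremeOdd n aLo aHi 1).eval (-ω ^ 2)))
        (ω * ((extremeOdd m bLo bHi 2).eval (-ω ^ 2) +
          c.re * (extremeOdd n aLo aHi 2).eval (-ω ^ 2)))) := fun h =>
    rectangle_avoids_zero hn (hdiag 1 1 (by decide)) (hdiag 1 2 (by decide))
      (hdiag 2 1 (by decide)) (hdiag 2 2 (by decide)) ω
      (by simpa only [eval_add, eval_mul, eval_C, add_comm] using h.1)
      (by simpa only [eval_add, eval_mul, eval_C, add_comm] using h.2)
  rw [eval_combination, eval_complexify_evenOdd, eval_complexify_evenOdd]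
  have hA := eval_evenPart_mem hq hu
  have hB := eval_oddPart_mem hq hu
  have ha' := eval_evenPart_mem hr hu
  have hb' := eval_oddPart_mem hr hu
  rcases le_total 0 ω with hω | hω
  · exact octagon_avoids_zero hx hy
      (fun z h1 h2 h3 => by
        have hz := hball z h1 h2 h3
        exact ⟨hV 1 1 1 1 (by decide) z hz, hV 1 2 1 2 (by decide) z hz,
          hV 2 2 2 2 (by decide) z hz, hV 2 1 2 1 (by decide) z hz, hV 1 1 1 2 (by decide) z hz,
          hV 1 2 2 2 (by decide) z hz, hV 2 2 2 1 (by decide) z hz, hV 2 1 1 1 (by decide) z hz⟩)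
      hR ha' (mul_mem_Icc_of_nonneg hω hb') hA (mul_mem_Icc_of_nonneg hω hB)
  -- For `ω ≤ 0` the factor `ω` reverses the order of the odd parts. Swapping the indices `1` and
  -- `2` of both odd parts brings in the remaining four mixed quadruples.
  · exact octagon_avoids_zero hx hy
      (fun z h1 h2 h3 => by
        have hz := hball z h1 h2 h3
        exact ⟨hV 1 2 1 2 (by decide) z hz, hV 1 1 1 1 (by decide) z hz,
          hV 2 1 2 1 (by decide) z hz, hV 2 2 2 2 (by decide) z hz, hV 1 2 1 1 (by decide) z hz,
          hV 1 1 2 1 (by decide) z hz, hV 2 1 2 2 (by decide) z hz, hV 2 2 1 2 (by decide) z hz⟩)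
      (by rwa [Set.uIcc_comm (ω * _)]) ha' (mul_mem_Icc_of_nonpos hω hb') hA
      (mul_mem_Icc_of_nonpos hω hB)

/-- If the twelve critical vertex combinations are stable for every multiplier `c` in a disc about
`1`, then `c * f + g` has no zero on the imaginary axis for all members of the two families. -/
lemma combination_avoids_zero (hmn : m < n)
    (hσ : ∀ x ∈ Set.Icc (aLo n) (aHi n), 0 < σ * x) (ha : ∀ i ≤ n, aLo i ≤ aHi i)
    (hb : ∀ i ≤ m, bLo i ≤ bHi i) (hρ : ρ < 1)
    (hV : ∀ i₁ j₁ i₂ j₂ : ℕ, (i₁, j₁, i₂, j₂) ∈ criticalIndices → ∀ c : ℂ, ‖c - 1‖ ≤ ρ →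
      IsStableNonconst (combination c (kharitonov n aLo aHi i₂ j₂) (kharitonov m bLo bHi i₁ j₁)))
    {f g : ℝ[X]} (hf : f ∈ intervalFamily n aLo aHi) (hg : g ∈ intervalFamily m bLo bHi)
    {c : ℂ} (hc : ‖c - 1‖ ≤ ρ) (ω : ℝ) :
    (combination c f g).eval (ω * Complex.I) ≠ 0 := by
  obtain ⟨q, hq, rfl⟩ := hf
  obtain ⟨r, hr, rfl⟩ := hg
  rw [sum_eq_evenOdd, sum_eq_evenOdd]
  rcases le_total 0 c.im with hy | hy
  · exact combination_avoids_zero_of_im_nonneg hmn hσ ha hb hρ hV hq hr hc hy ω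
  · have hc' : ‖(starRingEnd ℂ) c - 1‖ ≤ ρ := by
      rw [← map_one (starRingEnd ℂ), ← map_sub, RCLike.norm_conj]
      exact hc
    have h := combination_avoids_zero_of_im_nonneg hmn hσ ha hb hρ hV hq hr hc'
      (by rw [Complex.conj_im]; linarith) (-ω)
    rw [eval_combination_neg_conj] at h
    exact (_root_.map_ne_zero _).1 h

end Vertices

/-! ### The norm of the sensitivity function -/

section Sensitivity

variable {f g : ℝ[X]} {n : ℕ} {σ : ℝ}

lemma complexify_add (f g : ℝ[X]) : complexify (f + g) = complexify f + complexify g := by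
  simp only [complexify, Polynomial.map_add]

lemma sensitivity_eq (f g : ℝ[X]) (z : ℂ) :
    sensitivity f g z = (complexify f).eval z / (complexify (f + g)).eval z := by
  simp only [sensitivity, complexify, eval_map_algebraMap, map_add]

/-- The numerator is at most `K (1 + |ω|) ^ n` and the denominator at least `ε (1 + |ω|) ^ n`. -/
lemma hInfNorm_sensitivity_ne_top (hs : StableOfDegree n σ (f + g)) (hf : f.natDegree ≤ n) :
    hInfNorm (sensitivity f g) ≠ ⊤ := by
  obtain ⟨ε, hε, h1⟩ := hs.stable.exists_pos_mul_pow_le_norm_eval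
  rw [natDegree_complexify, hs.natDegree_eq] at h1
  obtain ⟨K, hK, h2⟩ := exists_norm_eval_le_mul_pow (complexify f) (n := n)
    ((natDegree_complexify f).trans_le hf)
  refine ne_top_of_le_ne_top ENNReal.ofReal_ne_top (b := ENNReal.ofReal (K / ε))
    (iSup_le fun ω => ?_)
  rw [← ofReal_norm]
  refine ENNReal.ofReal_le_ofReal ?_
  have hz : 0 ≤ ((ω : ℂ) * Complex.I).re := by simp
  have h3 := h1 _ hz
  have h4 := h2 (ω * Complex.I)
  have hp : 0 < (1 + ‖(ω : ℂ) * Complex.I‖) ^ n := by positivity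
  rw [sensitivity_eq, norm_div, div_le_div_iff₀ (lt_of_lt_of_le (by positivity) h3) hε]
  calc _ ≤ K * (1 + ‖(ω : ℂ) * Complex.I‖) ^ n * ε := mul_le_mul_of_nonneg_right h4 hε.le
    _ = K * (ε * (1 + ‖(ω : ℂ) * Complex.I‖) ^ n) := by ring
    _ ≤ _ := mul_le_mul_of_nonneg_left h3 hK

/-- The sensitivity function of a strictly proper loop tends to `1` at high frequency. -/
lemma one_le_hInfNorm_sensitivity (hs : StableOfDegree n σ (f + g)) {m : ℕ} (hmn : m < n)
    (hg : g.natDegree ≤ m) : 1 ≤ hInfNorm (sensitivity f g) := by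
  obtain ⟨ε, hε, h1⟩ := hs.stable.exists_pos_mul_pow_le_norm_eval
  rw [natDegree_complexify, hs.natDegree_eq] at h1
  obtain ⟨K, hK, h2⟩ := exists_norm_eval_le_mul_pow (complexify g) (n := m)
    ((natDegree_complexify g).trans_le hg)
  refine ENNReal.le_of_forall_pos_le_add fun η hη _ => ?_
  have hη' : (0 : ℝ) < η := hη
  -- The sensitivity differs from `1` by `g / (f + g)`, of modulus at most `K / (ε (1 + ω))` as `m <
  -- n`; this choice makes that at most `η`.
  set ω : ℝ := K / (ε * η) with hω
  have hω0 : 0 ≤ ω := by positivity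
  have hz : 0 ≤ ((ω : ℂ) * Complex.I).re := by simp
  have hnorm : ‖(ω : ℂ) * Complex.I‖ = ω := by
    rw [norm_mul, Complex.norm_I, mul_one, Complex.norm_real, Real.norm_of_nonneg hω0]
  have h3 := h1 _ hz
  have h4 := h2 (ω * Complex.I)
  rw [hnorm] at h3 h4
  have hne := hs.stable.eval_ne_zero hz
  have hpos : 0 < ‖(complexify (f + g)).eval (ω * Complex.I)‖ := norm_pos_iff.2 hne
  have h5 : ‖(complexify g).eval (ω * Complex.I)‖ ≤
      η * ‖(complexify (f + g)).eval (ω * Complex.I)‖ := by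
    have h6 : K ≤ η * ε * (1 + ω) := by
      have : η * ε * ω = K := by rw [hω]; field_simp
      nlinarith [mul_pos hη' hε]
    have h7 : (1 + ω) * (1 + ω) ^ m ≤ (1 + ω) ^ n := by
      rw [← pow_succ']
      exact pow_le_pow_right₀ (by linarith) hmn
    calc _ ≤ K * (1 + ω) ^ m := h4
      _ ≤ η * ε * (1 + ω) * (1 + ω) ^ m := mul_le_mul_of_nonneg_right h6 (by positivity)
      _ = η * ε * ((1 + ω) * (1 + ω) ^ m) := by ring
      _ ≤ η * ε * (1 + ω) ^ n := mul_le_mul_of_nonneg_left h7 (by positivity)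
      _ = η * (ε * (1 + ω) ^ n) := by ring
      _ ≤ _ := mul_le_mul_of_nonneg_left h3 hη'.le
  have h8 : (1 : ℝ) ≤ ‖sensitivity f g (ω * Complex.I)‖ + η := by
    have h9 : (1 : ℂ) = sensitivity f g (ω * Complex.I) +
        (complexify g).eval (ω * Complex.I) / (complexify (f + g)).eval (ω * Complex.I) := by
      rw [sensitivity_eq, ← add_div, ← eval_add, ← complexify_add, div_self hne]
    calc (1 : ℝ) = ‖(1 : ℂ)‖ := norm_one.symm
      _ ≤ _ := by
        conv_lhs => rw [h9]
        refine (norm_add_le _ _).trans (add_le_add le_rfl ?_)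
        rw [norm_div, div_le_iff₀ hpos]
        exact h5
  calc (1 : ℝ≥0∞) = ENNReal.ofReal 1 := ENNReal.ofReal_one.symm
    _ ≤ ENNReal.ofReal (‖sensitivity f g (ω * Complex.I)‖ + η) := ENNReal.ofReal_le_ofReal h8
    _ = ‖sensitivity f g (ω * Complex.I)‖ₑ + η := by
      rw [ENNReal.ofReal_add (norm_nonneg _) hη'.le, ofReal_norm,
        ENNReal.ofReal_coe_nnreal]
    _ ≤ _ := add_le_add (le_iSup (fun ω : ℝ => ‖sensitivity f g (ω * Complex.I)‖ₑ) ω) le_rfl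

lemma norm_lt_of_hInfNorm_le {μ : ℝ≥0} (hs : StableOfDegree n σ (f + g))
    (h : hInfNorm (sensitivity f g) ≤ μ) {γ : ℝ} (hγ : μ < γ) (ω : ℝ) :
    ‖(complexify f).eval (ω * Complex.I)‖ <
      γ * ‖(complexify (f + g)).eval (ω * Complex.I)‖ := by
  have h1 : ‖sensitivity f g (ω * Complex.I)‖ₑ ≤ μ :=
    (le_iSup (fun ω : ℝ => ‖sensitivity f g (ω * Complex.I)‖ₑ) ω).trans h
  rw [enorm_le_coe, ← NNReal.coe_le_coe, coe_nnnorm, sensitivity_eq, norm_div] at h1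
  have hpos : 0 < ‖(complexify (f + g)).eval (ω * Complex.I)‖ :=
    norm_pos_iff.2 (hs.stable.eval_ne_zero (by simp))
  exact (div_lt_iff₀ hpos).1 (h1.trans_lt hγ)

lemma norm_sensitivity_le_of_combination_ne_zero {γ : ℝ} (hγ : 0 < γ) {z : ℂ}
    (h : ∀ c : ℂ, ‖c - 1‖ ≤ 1 / γ → (combination c f g).eval z ≠ 0) :
    ‖sensitivity f g z‖ ≤ γ := by
  by_contra hlt
  push Not at hlt
  have hf : (complexify f).eval z ≠ 0 := by
    intro h0
    rw [sensitivity_eq, h0, zero_div, norm_zero] at hlt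
    linarith
  -- This `c` annihilates `c f + g` at `z`, and `c - 1` is minus the inverse of the sensitivity.
  refine h (-(complexify g).eval z / (complexify f).eval z) ?_ ?_
  · have h1 : -(complexify g).eval z / (complexify f).eval z - 1 = -(sensitivity f g z)⁻¹ := by
      rw [sensitivity_eq, inv_div, complexify_add, eval_add]
      field_simp
      ring
    rw [h1, norm_neg, norm_inv, one_div]
    exact inv_anti₀ hγ hlt.le
  · rw [eval_combination]
    field_simp
    ring

end Sensitivity

/-! ### Equality of the two maxima -/

theorem theorem5 (m n : ℕ) (hmn : m < n)
    (bLo bHi aLo aHi : ℕ → ℝ)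
    (hb : ∀ i ≤ m, bLo i ≤ bHi i)
    (ha : ∀ i ≤ n, aLo i ≤ aHi i)
    (hlead : (0 : ℝ) ∉ Set.Icc (aLo n) (aHi n))
    (hH : ∀ i ∈ ({1, 2} : Set ℕ), ∀ j ∈ ({1, 2} : Set ℕ),
      Hurwitz (kharitonov m bLo bHi i j + kharitonov n aLo aHi i j)) :
    (∀ g ∈ intervalFamily m bLo bHi, ∀ f ∈ intervalFamily n aLo aHi, Hurwitz (f + g)) ∧
    ∃ γ : ℝ≥0,
      IsGreatest {N : ℝ≥0∞ | ∃ g ∈ intervalFamily m bLo bHi, ∃ f ∈ intervalFamily n aLo aHi,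
        N = hInfNorm (sensitivity f g)} (γ : ℝ≥0∞) ∧
      IsGreatest {N : ℝ≥0∞ | ∃ i₁ j₁ i₂ j₂ : ℕ, (i₁, j₁, i₂, j₂) ∈ criticalIndices ∧
        N = hInfNorm (sensitivity (kharitonov n aLo aHi i₂ j₂)
          (kharitonov m bLo bHi i₁ j₁))} (γ : ℝ≥0∞) := by
  have hn : 0 < n := Nat.zero_lt_of_lt hmn
  obtain ⟨σ, hσ⟩ := exists_sign hlead
  have hstable : ∀ g ∈ intervalFamily m bLo bHi, ∀ f ∈ intervalFamily n aLo aHi,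
      StableOfDegree n σ (f + g) := by
    refine fun g hg f hf => stableOfDegree_add_of_mem hmn hσ (fun i hi j hj => ?_) hg hf
    have hf' := kharitonov_mem_intervalFamily ha i j
    have hgd := (natDegree_le_of_mem_intervalFamily
      (kharitonov_mem_intervalFamily hb i j)).trans_lt hmn
    refine ⟨?_, natDegree_add_le_of_degree_le (natDegree_le_of_mem_intervalFamily hf') hgd.le, ?_⟩
    · rw [add_comm]
      exact hurwitz_iff_isStable.1 (hH i hi j hj)
    · rw [coeff_add_of_natDegree_lt hgd]
      exact hσ _ (coeff_mem_of_mem_intervalFamily hf')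
  refine ⟨fun g hg f hf => hurwitz_iff_isStable.2 (hstable g hg f hf).stable, ?_⟩
  have hK : ∀ i j, kharitonov n aLo aHi i j ∈ intervalFamily n aLo aHi :=
    kharitonov_mem_intervalFamily ha
  have hL : ∀ i j, kharitonov m bLo bHi i j ∈ intervalFamily m bLo bHi :=
    kharitonov_mem_intervalFamily hb
  -- The common maximum is the largest norm over the finite set of critical quadruples. Vertices
  -- belong to the families, so only the upper bound over all members remains.
  obtain ⟨⟨k₁, l₁, k₂, l₂⟩, hk, hmax⟩ := criticalIndices.exists_max_image
    (fun v => hInfNorm (sensitivity (kharitonov n aLo aHi v.2.2.1 v.2.2.2)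
      (kharitonov m bLo bHi v.1 v.2.1))) ⟨(1, 1, 1, 1), by decide⟩
  have hsv := hstable _ (hL k₁ l₁) _ (hK k₂ l₂)
  obtain ⟨μ, hμ⟩ : ∃ μ : ℝ≥0, (μ : ℝ≥0∞) = hInfNorm (sensitivity (kharitonov n aLo aHi k₂ l₂)
      (kharitonov m bLo bHi k₁ l₁)) :=
    ⟨_, ENNReal.coe_toNNReal (hInfNorm_sensitivity_ne_top hsv
      (natDegree_le_of_mem_intervalFamily (hK k₂ l₂)))⟩
  have hμ1 : 1 ≤ μ := by
    have := one_le_hInfNorm_sensitivity hsv hmn (natDegree_le_of_mem_intervalFamily (hL k₁ l₁))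
    rw [← hμ] at this
    exact_mod_cast this
  refine ⟨μ, ⟨⟨_, hL k₁ l₁, _, hK k₂ l₂, hμ⟩, ?_⟩, ⟨⟨k₁, l₁, k₂, l₂, hk, hμ⟩, ?_⟩⟩
  · rintro _ ⟨g, hg, f, hf, rfl⟩
    -- The slack `η` gives the strict inequalities that the small-gain argument needs, including `μ
    -- + η > 1` when `μ = 1`.
    refine iSup_le fun ω => ENNReal.le_of_forall_pos_le_add fun η hη _ => ?_
    have hη' : (0 : ℝ) < η := hη
    have hμ1' : (1 : ℝ) ≤ μ := hμ1
    have hγ : (1 : ℝ) < μ + η := by linarith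
    rw [← ENNReal.coe_add, enorm_le_coe, ← NNReal.coe_le_coe, coe_nnnorm, NNReal.coe_add]
    refine norm_sensitivity_le_of_combination_ne_zero (by linarith) fun c hc => ?_
    refine combination_avoids_zero (ρ := 1 / (μ + η)) hmn hσ ha hb
      (by rw [div_lt_one (by linarith)]; exact hγ) (fun i₁ j₁ i₂ j₂ hI c' hc' => ?_) hf hg hc ω
    have hs := hstable _ (hL i₁ j₁) _ (hK i₂ j₂)
    refine isStableNonconst_combination hn hs.stable
      (natDegree_le_of_mem_intervalFamily (hK i₂ j₂)) (fun h0 => ?_)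
      ((natDegree_le_of_mem_intervalFamily (hL i₁ j₁)).trans_lt hmn) hγ
      (fun w => norm_lt_of_hInfNorm_le hs ((hmax _ hI).trans_eq hμ.symm) (by linarith) w) hc'
    have := hσ _ (coeff_mem_of_mem_intervalFamily (hK i₂ j₂))
    rw [h0, mul_zero] at this
    exact lt_irrefl _ this
  · rintro _ ⟨i₁, j₁, i₂, j₂, hI, rfl⟩
    exact (hmax _ hI).trans_eq hμ.symm
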